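/- Let $G$ be the complex Heisenberg group of matrices $\begin{pmatrix}1&z^1&z^3\\0&1&z^2\\0&0&1\end{pmatrix}$ with $z^i\in\mathbb C$, let $\mathfrak g$ be its Lie algebra (regarded as a real Lie algebra), and let $M=\Gamma\backslash G$ be the Iwasawa manifold, where $\Gamma\subset G$ is the subgroup of matrices with Gaussian integer entries. Invariant tensors on $M$ are those induced by left-invariant tensors on $G$. Let $\mathcal C\subset\operatorname{End}_{\mathbb R}(\mathfrak g)$ be the set of invariant complex structures on $M$, i.e. of those $J$ with $J^2=-1$ whose left-invariant extension is integrable; let $J_0\in\mathcal C$ be the bi-invariant complex structure of $G$ (multiplication by $i$). For $J\in\mathcal C$, an invariant metric $g$ for which $J$ is orthogonal, with fundamental form $\Omega$ given by $g(X,Y)=\Omega(X,JY)$, is called SKT if $\partial\bar\partial\,\Omega=0$ (equivalently $dJd\,\Omega=0$) but $d\Omega\neq0$. The structure $J$ is called SKT if it admits an invariant SKT metric. Let $\omega^1=dz^1$, $\omega^2=dz^2$, $\omega^3=-dz^3+z^1dz^2$. For $\mathbf X=\begin{pmatrix}a&b\\c&d\end{pmatrix}\in M_2(\mathbb C)$ and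 $x,y\in\mathbb C$, let $J_{\mathbf X,x,y}$ denote, when it exists, the invariant almost complex structure whose space of $(1,0)$-forms is spanned by $$\alpha^1=\omega^1+a\,\bar\omega^1+b\,\bar\omega^2,\qquad \alpha^2=\omega^2+c\,\bar\omega^1+d\,\bar\omega^2,\qquad \alpha^3=\omega^3+x\,\bar\omega^1+y\,\bar\omega^2-(\det\mathbf X)\,\bar\omega^3 .$$ Theorem. (1) For all $P\in GL(2,\mathbb C)$, all $x,y\in\mathbb C$ and every $z\in\mathbb C$ with $z\ne1$ and $$(1+|z|^2)\,|1+z|^2=8|z|^2,\qquad(*)$$ the structure $J_{\mathbf X,x,y}$ with $\mathbf X=P^{-1}\begin{pmatrix}0&z\\1&0\end{pmatrix}\overline P$ exists, is unique, and lies in $\mathcal C$. (2) An invariant complex structure $J\in\mathcal C$ is SKT if and only if $J=J_{\mathbf X,x,y}$ with $\mathbf X=P^{-1}\begin{pmatrix}0&z\\1&0\end{pmatrix}\overline P$ for some $P\in GL(2,\mathbb C)$, some $x,y\in\mathbb C$ and some $z\neq1$ satisfying $(*)$. (3) If $J\in\mathcal C$ is SKT, then every invariant metric for which $J$ is orthogonal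 is SKT. (4) Every SKT structure $J\in\mathcal C$ lies in the connected component of $J_0$ or in the connected component of $-J_0$ in $\mathcal C$. -/

import Mathlib

open scoped Matrix

namespace Iwasawa

/-! ### The complex Heisenberg group

`G` is the group of complex upper unitriangular `3 × 3` matrices, with global coordinates
`(z¹, z², z³)` (indexed by `0, 1, 2`), and the Iwasawa manifold is `M = Γ \ G`, where `Γ ⊆ G` is the
discrete subgroup of matrices with Gaussian integer entries.  An invariant tensor on `M` is one that
is induced by a left-invariant tensor on `G`; since `G → M` is a covering map, an equation between
such tensors and their exterior derivatives or brackets holds on `M` if and only if it holds on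
`G`. -/

/-- The coordinate space `ℂ³` of the complex Heisenberg group `G`.  It is also used for each tangent
space of `G`; the tangent space at the identity `0` is the Lie algebra `𝔤`. -/
abbrev E : Type := Fin 3 → ℂ

/-- The matrix with coordinates `z`. -/
def toMatrix (z : E) : Matrix (Fin 3) (Fin 3) ℂ :=
  !![1, z 0, z 2; 0, 1, z 1; 0, 0, 1]

/-- Multiplication of `G` in coordinates. -/
def mul (p q : E) : E := ![p 0 + q 0, p 1 + q 1, p 2 + q 2 + p 0 * q 1]

/-- Inversion of `G` in coordinates. -/
def inv (p : E) : E := ![-p 0, -p 1, -p 2 + p 0 * p 1]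

theorem toMatrix_injective : Function.Injective toMatrix := by
  intro p q h
  have h01 := congrFun (congrFun h 0) 1
  have h02 := congrFun (congrFun h 0) 2
  have h12 := congrFun (congrFun h 1) 2
  simp [toMatrix] at h01 h02 h12
  ext i
  fin_cases i <;> simp [h01, h02, h12]

theorem toMatrix_zero : toMatrix 0 = 1 := by
  ext i j
  fin_cases i <;> fin_cases j <;> simp [toMatrix]

theorem toMatrix_mul (p q : E) : toMatrix (mul p q) = toMatrix p * toMatrix q := by
  ext i j
  fin_cases i <;> fin_cases j <;>
    simp [toMatrix, mul, Matrix.mul_apply, Fin.sum_univ_three] <;> ring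

theorem mul_inv (p : E) : mul p (inv p) = 0 := by
  ext i
  fin_cases i <;> simp [mul, inv]

theorem inv_mul (p : E) : mul (inv p) p = 0 := by
  ext i
  fin_cases i <;> simp [mul, inv]

/-! ### Left-invariant tensors on `G` -/

/-- The differential at `q` of the left translation `q ↦ p q`. -/
noncomputable def dLeft (p q : E) : E →L[ℝ] E := fderiv ℝ (mul p) q

/-- The left-invariant vector field on `G` with value `v` at the identity. -/
noncomputable def invField (v : E) (p : E) : E := dLeft p 0 v

/-- The left-invariant differential form on `G` with value `ω` at the identity. -/
noncomputable def invForm {k : ℕ} (ω : E [⋀^Fin k]→L[ℝ] ℝ) (p : E) : E [⋀^Fin k]→L[ℝ] ℝ :=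
  ω.compContinuousLinearMap (dLeft (inv p) p)

/-- The left-invariant endomorphism of the tangent bundle of `G` with value `J` at the identity. -/
noncomputable def invEnd (J : E →L[ℝ] E) (p : E) : E →L[ℝ] E :=
  (dLeft p 0).comp (J.comp (dLeft (inv p) p))

/-! ### Invariant complex structures -/

/-- The Nijenhuis tensor of the left-invariant almost complex structure determined by `J`, on the
left-invariant vector fields with values `v` and `w` at the identity. -/
noncomputable def nijenhuis (J : E →L[ℝ] E) (v w : E) (p : E) : E :=
  VectorField.lieBracket ℝ (invField (J v)) (invField (J w)) p
    - invEnd J p (VectorField.lieBracket ℝ (invField (J v)) (invField w) p)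
    - invEnd J p (VectorField.lieBracket ℝ (invField v) (invField (J w)) p)
    - VectorField.lieBracket ℝ (invField v) (invField w) p

/-- The set `𝒞` of invariant complex structures on the Iwasawa manifold, as a subset of the space of
endomorphisms of `𝔤` (with its usual topology). -/
def complexStructures : Set (E →L[ℝ] E) :=
  {J | (∀ v, J (J v) = -v) ∧ ∀ v w p, nijenhuis J v w p = 0}

/-- The bi-invariant complex structure `J₀` of the complex Lie group `G`. -/
noncomputable def J₀ : E →L[ℝ] E := Complex.I • ContinuousLinearMap.id ℝ E

/-! ### The SKT condition -/

/-- `g` is (the value at the identity of) an invariant Riemannian metric for which `J` is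
orthogonal. -/
structure IsHermitianMetric (J : E →L[ℝ] E) (g : E →L[ℝ] E →L[ℝ] ℝ) : Prop where
  symm : ∀ v w, g v w = g w v
  pos : ∀ v, v ≠ 0 → 0 < g v v
  orthogonal : ∀ v w, g (J v) (J w) = g v w

/-- `Ω` is the fundamental form of `(J, g)`: `g(v, w) = Ω(v, J w)`. -/
def IsFundamentalForm (J : E →L[ℝ] E) (g : E →L[ℝ] E →L[ℝ] ℝ) (Ω : E [⋀^Fin 2]→L[ℝ] ℝ) : Prop :=
  ∀ v w, g v w = Ω ![v, J w]

/-- The 4-form `d J d Ω` on `G`, where `J` acts on a `k`-form `β` by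
`(J β)(v₁, …, v_k) = β(J v₁, …, J v_k)`.  It is a nonzero constant multiple of `∂ ∂̄ Ω`. -/
noncomputable def dJd (J : E →L[ℝ] E) (Ω : E [⋀^Fin 2]→L[ℝ] ℝ) : E → E [⋀^Fin 4]→L[ℝ] ℝ :=
  extDeriv fun p => (extDeriv (invForm Ω) p).compContinuousLinearMap (invEnd J p)

/-- The invariant Hermitian metric `g` is strong KT: its fundamental form `Ω` satisfies
`∂ ∂̄ Ω = 0` but `d Ω ≠ 0`. -/
def IsSKTMetric (J : E →L[ℝ] E) (g : E →L[ℝ] E →L[ℝ] ℝ) : Prop :=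
  IsHermitianMetric J g ∧
    ∃ Ω, IsFundamentalForm J g Ω ∧ dJd J Ω = 0 ∧ extDeriv (invForm Ω) ≠ 0

/-- `J` is SKT: it admits an invariant strong KT metric. -/
def IsSKT (J : E →L[ℝ] E) : Prop := ∃ g, IsSKTMetric J g

/-! ### The complex structures `J_{X,x,y}` -/

/-- The space `Λ ⊆ 𝔤_c^*` of `(1,0)`-forms of `J`. -/
noncomputable def oneZeroForms (J : E →L[ℝ] E) : Submodule ℂ (E →L[ℝ] ℂ) where
  carrier := {α | ∀ v, α (J v) = Complex.I * α v}
  add_mem' := by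
    intro α β hα hβ v
    simp only [add_apply, hα v, hβ v]
    ring
  zero_mem' := by
    intro v
    simp
  smul_mem' := by
    intro c α hα v
    simp only [smul_apply, hα v, smul_eq_mul]
    ring

/-- The values at the identity of the left-invariant forms `ω¹ = dz¹`, `ω² = dz²`,
`ω³ = -dz³ + z¹ dz²`. -/
noncomputable def ω : Fin 3 → (E →L[ℝ] ℂ) :=
  ![ContinuousLinearMap.proj 0, ContinuousLinearMap.proj 1, -ContinuousLinearMap.proj 2]

/-- The complex conjugate of a complex-valued form. -/
noncomputable def conjForm (α : E →L[ℝ] ℂ) : E →L[ℝ] ℂ :=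
  (Complex.conjCLE : ℂ →L[ℝ] ℂ).comp α

/-- The space spanned by
`α¹ = ω¹ + a ω̄¹ + b ω̄²`, `α² = ω² + c ω̄¹ + d ω̄²`, `α³ = ω³ + x ω̄¹ + y ω̄² + u ω̄³`,
where `X = (a b; c d)` and `u = -det X`. -/
noncomputable def Λ (X : Matrix (Fin 2) (Fin 2) ℂ) (x y : ℂ) : Submodule ℂ (E →L[ℝ] ℂ) :=
  Submodule.span ℂ
    {ω 0 + X 0 0 • conjForm (ω 0) + X 0 1 • conjForm (ω 1),
     ω 1 + X 1 0 • conjForm (ω 0) + X 1 1 • conjForm (ω 1),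
     ω 2 + x • conjForm (ω 0) + y • conjForm (ω 1) + (-X.det) • conjForm (ω 2)}

/-- `J` equals `J_{X,x,y}`, the almost complex structure whose space of `(1,0)`-forms is
`Λ X x y`. -/
def IsJ (X : Matrix (Fin 2) (Fin 2) ℂ) (x y : ℂ) (J : E →L[ℝ] E) : Prop :=
  (∀ v, J (J v) = -v) ∧ oneZeroForms J = Λ X x y

/-- The matrix `P⁻¹ (0 z; 1 0) P̄`. -/
noncomputable def normalForm (P : GL (Fin 2) ℂ) (z : ℂ) : Matrix (Fin 2) (Fin 2) ℂ :=
  (P⁻¹ : GL (Fin 2) ℂ).val * !![0, z; 1, 0] * P.val.map (starRingEnd ℂ)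

/-- The curve `(1 + |z|²) |1 + z|² = 8 |z|²` with the point `z = 1` removed. -/
def curve : Set ℂ :=
  {z | (1 + ‖z‖ ^ 2) * ‖1 + z‖ ^ 2 = 8 * ‖z‖ ^ 2 ∧ z ≠ 1}

end Iwasawa

namespace Iwasawa

/-! The commutator of 𝔤 is its centre Z, which every integrable J preserves (`apply_central`). Hence
dJdΩ(a,b,c,d) is the signed sum of g([a,b],[Jc,Jd]) over the splittings of the four vectors into
pairs (`dJd_eq_zero_iff`), and sees g only on Z. Since Z is a complex line for J, a J-orthogonal
metric is determined on Z up to a positive factor (`metric_centre`), so the SKT condition depends on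
J alone; dΩ ≠ 0 is automatic (`isSKTMetric_iff`).

If a noncentral u commuted with Ju, then dJdΩ(u,Ju,v,Jv) would be minus a sum of squares, not all
zero. So an SKT structure has no such u (`br_apply_ne_zero`), and consequently no (1,0)-form lπ +
kπ̄ with π a nonzero combination of ω¹, ω² and (l,k) ≠ 0. This puts J in the form J_{X,x,y}
(`exists_coframe`) and makes v and X v̄ independent for all v ≠ 0. An eigenvector v of X X̄ then
gives the basis v, X v̄ that brings X to the form P⁻¹(0 z; 1 0)P̄ (`exists_normalForm`).

For this normal form dα³ is explicit in α¹, α² and their conjugates, and dJdΩ becomes a positive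
multiple of the function defining the curve times a volume form (`torsion_splitting`,
`sktForm_normalForm`). On the curve |z| = 1 would force z = 1. Thus |z| ≠ 1, and shrinking the
conjugate part of the coframe (|z| < 1) or its holomorphic part (|z| > 1) to zero joins J to J₀ or
to -J₀. -/

/-- The Lie bracket of `𝔤` in coordinates. -/
def br (v w : E) : E := ![0, 0, v 0 * w 1 - v 1 * w 0]

@[simp] theorem br_zero (v w : E) : br v w 0 = 0 := rfl
@[simp] theorem br_one (v w : E) : br v w 1 = 0 := rfl
@[simp] theorem br_two (v w : E) : br v w 2 = v 0 * w 1 - v 1 * w 0 := rfl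

theorem ext_coords {v w : E} (h0 : v 0 = w 0) (h1 : v 1 = w 1) (h2 : v 2 = w 2) : v = w := by
  ext i
  fin_cases i <;> assumption

/-! ### Left translations, invariant fields and the Nijenhuis tensor in coordinates -/

/-- The linear map `v ↦ (0, 0, c v²)`, where `v²` is the second coordinate of `v`. -/
noncomputable def shear (c : ℂ) : E →L[ℝ] E :=
  (ContinuousLinearMap.single ℝ (fun _ : Fin 3 => ℂ) 2).comp
    (c • (ContinuousLinearMap.proj 1 : E →L[ℝ] ℂ))

@[simp] theorem shear_apply_zero (c : ℂ) (v : E) : shear c v 0 = 0 := by simp [shear]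
@[simp] theorem shear_apply_one (c : ℂ) (v : E) : shear c v 1 = 0 := by simp [shear]
@[simp] theorem shear_apply_two (c : ℂ) (v : E) : shear c v 2 = c * v 1 := by simp [shear]

@[simp] theorem inv_zero : inv 0 = 0 := by
  ext i
  fin_cases i <;> simp [inv]

theorem hasFDerivAt_mul (p q : E) :
    HasFDerivAt (mul p) (ContinuousLinearMap.id ℝ E + shear (p 0)) q := by
  have h : mul p = fun q => (ContinuousLinearMap.id ℝ E + shear (p 0)) q + p := by
    funext q
    ext i
    fin_cases i <;> simp [mul] <;> ring
  rw [h]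
  exact (ContinuousLinearMap.hasFDerivAt _).add_const p

theorem dLeft_eq (p q : E) : dLeft p q = ContinuousLinearMap.id ℝ E + shear (p 0) :=
  (hasFDerivAt_mul p q).fderiv

theorem dLeft_apply (p q v : E) : dLeft p q v = ![v 0, v 1, v 2 + p 0 * v 1] := by
  rw [dLeft_eq]
  ext i
  fin_cases i <;> simp

@[simp] theorem dLeft_zero (q : E) : dLeft 0 q = ContinuousLinearMap.id ℝ E := by
  ext v i
  fin_cases i <;> simp [dLeft_apply]

theorem dLeft_inv_dLeft (p q q' v : E) : dLeft (inv p) q (dLeft p q' v) = v := by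
  ext i
  fin_cases i <;> simp [dLeft_apply, inv]

theorem dLeft_dLeft_inv (p q q' v : E) : dLeft p q (dLeft (inv p) q' v) = v := by
  ext i
  fin_cases i <;> simp [dLeft_apply, inv]

theorem dLeft_br (p q v w : E) : dLeft p q (br v w) = br v w := by
  ext i
  fin_cases i <;> simp [dLeft_apply]

theorem dLeft_inv_invField (p q v : E) : dLeft (inv p) q (invField v p) = v :=
  dLeft_inv_dLeft ..

theorem hasFDerivAt_invField (v p : E) :
    HasFDerivAt (invField v)
      ((ContinuousLinearMap.single ℝ (fun _ : Fin 3 => ℂ) 2).comp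
        (v 1 • (ContinuousLinearMap.proj 0 : E →L[ℝ] ℂ))) p := by
  have h : invField v = fun p => ((ContinuousLinearMap.single ℝ (fun _ : Fin 3 => ℂ) 2).comp
        (v 1 • (ContinuousLinearMap.proj 0 : E →L[ℝ] ℂ))) p + v := by
    funext p
    ext i
    fin_cases i <;> simp [invField, dLeft_apply]
    ring
  rw [h]
  exact (ContinuousLinearMap.hasFDerivAt _).add_const v

theorem lieBracket_invField (v w p : E) :
    VectorField.lieBracket ℝ (invField v) (invField w) p = br v w := by
  rw [VectorField.lieBracket, (hasFDerivAt_invField v p).fderiv, (hasFDerivAt_invField w p).fderiv]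
  ext i
  fin_cases i <;> simp [invField, dLeft_apply]
  ring

theorem nijenhuis_eq (J : E →L[ℝ] E) (v w p : E) :
    nijenhuis J v w p =
      dLeft p 0 (br (J v) (J w) - J (br (J v) w) - J (br v (J w)) - br v w) := by
  simp only [nijenhuis, lieBracket_invField, invEnd, ContinuousLinearMap.comp_apply, dLeft_br,
    map_sub]

theorem mem_complexStructures_iff (J : E →L[ℝ] E) :
    J ∈ complexStructures ↔ (∀ v, J (J v) = -v) ∧
      ∀ v w, br (J v) (J w) - J (br (J v) w) - J (br v (J w)) - br v w = 0 := by
  refine and_congr_right fun _ => ⟨fun h v w => ?_, fun h v w p => ?_⟩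
  · simpa [nijenhuis_eq] using h v w 0
  · rw [nijenhuis_eq, h, map_zero]

/-! ### Exterior derivatives of invariant forms -/

theorem differentiable_invForm {k : ℕ} (ω : E [⋀^Fin k]→L[ℝ] ℝ) : Differentiable ℝ (invForm ω) := by
  intro p
  refine (differentiableAt_const ω).continuousAlternatingMapCompContinuousLinearMap ?_
  have h : (fun p : E => dLeft (inv p) p) = fun p =>
      ContinuousLinearMap.id ℝ E - (ContinuousLinearMap.compL ℝ E ℂ E
        (ContinuousLinearMap.single ℝ (fun _ : Fin 3 => ℂ) 2))
        (p 0 • (ContinuousLinearMap.proj 1 : E →L[ℝ] ℂ)) := by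
    funext p
    ext v i
    fin_cases i <;> simp [dLeft_apply, inv]
    ring
  rw [h]
  fun_prop

theorem invForm_invField {k : ℕ} (ω : E [⋀^Fin k]→L[ℝ] ℝ) (v : Fin k → E) (p : E) :
    invForm ω p (fun i => invField (v i) p) = ω v := by
  simp only [invForm, ContinuousAlternatingMap.compContinuousLinearMap_apply]
  congr 1
  funext i
  exact dLeft_inv_invField ..

/-- An invariant form is constant on left-invariant fields, so the derivative terms of the invariant
formula for d vanish and only the bracket terms remain. -/
theorem extDeriv_invForm_invField {n : ℕ} (ω : E [⋀^Fin (n + 1)]→L[ℝ] ℝ) (v : Fin (n + 2) → E)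
    (p : E) :
    extDeriv (invForm ω) p (fun i => invField (v i) p) =
      -∑ i : Fin (n + 1), ∑ j ≥ i, (-1) ^ (i + j : ℕ) •
          ω (Matrix.vecCons (br (v i.castSucc) (v j.succ))
            (j.removeNth <| i.castSucc.removeNth v)) := by
  rw [extDeriv_apply_vectorField (V := fun i => invField (v i)) (differentiable_invForm ω p)
    fun i => (hasFDerivAt_invField _ _).differentiableAt]
  have h (i : Fin (n + 2)) :
      (fun x => invForm ω x (i.removeNth fun i => invField (v i) x)) =
        fun _ => ω (i.removeNth v) := by
    funext x
    exact invForm_invField ω (i.removeNth v) x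
  simp only [h, fderiv_const_apply, zero_apply, smul_zero,
    Finset.sum_const_zero, zero_sub, lieBracket_invField]
  congr 1
  refine Finset.sum_congr rfl fun i _ => Finset.sum_congr rfl fun j _ => ?_
  congr 1
  rw [← invForm_invField ω _ p]
  congr 1
  funext k
  refine Fin.cases ?_ (fun k => ?_) k
  · simp [invField, dLeft_br]
  · simp [Fin.removeNth]

theorem invForm_dLeft {k : ℕ} (ω : E [⋀^Fin k]→L[ℝ] ℝ) (v : Fin k → E) (p : E) :
    invForm ω p v = ω (fun i => dLeft (inv p) p (v i)) := rfl

/-- The exterior derivative of an invariant form is invariant. -/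
theorem extDeriv_invForm {n : ℕ} (ω : E [⋀^Fin (n + 1)]→L[ℝ] ℝ) :
    extDeriv (invForm ω) = invForm (extDeriv (invForm ω) 0) := by
  funext p
  ext v
  rw [invForm_dLeft]
  have h0 := extDeriv_invForm_invField ω (fun i => dLeft (inv p) p (v i)) 0
  have hp := extDeriv_invForm_invField ω (fun i => dLeft (inv p) p (v i)) p
  rw [← h0] at hp
  simpa only [invField, dLeft_dLeft_inv, dLeft_zero, ContinuousLinearMap.id_apply] using hp

theorem extDeriv_invForm_zero_apply {n : ℕ} (ω : E [⋀^Fin (n + 1)]→L[ℝ] ℝ) (v : Fin (n + 2) → E) :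
    extDeriv (invForm ω) 0 v =
      -∑ i : Fin (n + 1), ∑ j ≥ i, (-1) ^ (i + j : ℕ) •
          ω (Matrix.vecCons (br (v i.castSucc) (v j.succ))
            (j.removeNth <| i.castSucc.removeNth v)) := by
  rw [← extDeriv_invForm_invField ω v 0]
  simp [invField]

theorem extDeriv_invForm_two (Ω : E [⋀^Fin 2]→L[ℝ] ℝ) (u v w : E) :
    extDeriv (invForm Ω) 0 ![u, v, w] =
      -(Ω ![br u v, w] - Ω ![br u w, v] + Ω ![br v w, u]) := by
  rw [extDeriv_invForm_zero_apply, Fin.sum_univ_two, show Finset.Ici (0 : Fin 2) = {0, 1} by decide,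
    show Finset.Ici (1 : Fin 2) = {1} by decide, Finset.sum_pair (by decide), Finset.sum_singleton]
  have h1 : Fin.removeNth 1 (Fin.removeNth 1 ![u, v, w]) = ![u] := by
    funext i; fin_cases i; rfl
  have h2 : Fin.removeNth 1 ![v, w] = ![v] := by
    funext i; fin_cases i; rfl
  simp [h1, h2]
  ring

theorem extDeriv_invForm_three (β : E [⋀^Fin 3]→L[ℝ] ℝ) (a b c d : E) :
    extDeriv (invForm β) 0 ![a, b, c, d] =
      -(β ![br a b, c, d] - β ![br a c, b, d] + β ![br a d, b, c] + β ![br b c, a, d] -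
        β ![br b d, a, c] + β ![br c d, a, b]) := by
  rw [extDeriv_invForm_zero_apply, Fin.sum_univ_three,
    show Finset.Ici (0 : Fin 3) = {0, 1, 2} by decide,
    show Finset.Ici (1 : Fin 3) = {1, 2} by decide, show Finset.Ici (2 : Fin 3) = {2} by decide,
    Finset.sum_insert (by decide), Finset.sum_pair (by decide), Finset.sum_pair (by decide),
    Finset.sum_singleton]
  have h1 : Fin.removeNth 1 (Fin.removeNth 1 ![a, b, c, d]) = ![a, d] := by
    funext i; fin_cases i <;> rfl
  have h2 : Fin.removeNth 2 (Fin.removeNth 1 ![a, b, c, d]) = ![a, c] := by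
    funext i; fin_cases i <;> rfl
  have h3 : Fin.removeNth 2 (Fin.removeNth 2 ![a, b, c, d]) = ![a, b] := by
    funext i; fin_cases i <;> rfl
  have h4 : Fin.removeNth 1 ![b, c, d] = ![b, d] := by
    funext i; fin_cases i <;> rfl
  have h5 : Fin.removeNth 2 ![b, c, d] = ![b, c] := by
    funext i; fin_cases i <;> rfl
  simp [h1, h2, h3, h4, h5]
  ring

/-! ### The form `dJdΩ` -/

/-- The sum over the splittings of four vectors into two pairs that computes `dJdΩ`. -/
noncomputable def sktForm (J : E →L[ℝ] E) (g : E →L[ℝ] E →L[ℝ] ℝ) (a b c d : E) : ℝ :=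
  g (br a b) (br (J c) (J d)) - g (br a c) (br (J b) (J d)) + g (br a d) (br (J b) (J c)) +
    g (br b c) (br (J a) (J d)) - g (br b d) (br (J a) (J c)) + g (br c d) (br (J a) (J b))

theorem br_central_left {c : E} (h0 : c 0 = 0) (h1 : c 1 = 0) (v : E) : br c v = 0 :=
  ext_coords rfl rfl (by simp [h0, h1])

theorem dJd_eq_invForm (J : E →L[ℝ] E) (Ω : E [⋀^Fin 2]→L[ℝ] ℝ) :
    dJd J Ω = extDeriv
      (invForm ((extDeriv (invForm Ω) 0).compContinuousLinearMap J)) := by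
  unfold dJd
  congr 1
  funext p
  ext v
  rw [extDeriv_invForm]
  simp only [ContinuousAlternatingMap.compContinuousLinearMap_apply, invForm_dLeft]
  congr 1
  funext i
  simp [invEnd, dLeft_inv_dLeft]

/-- In dΩ(J[u,v], Jx, Jy) the vector J[u,v] is central, so only the bracket [Jx,Jy] survives, and
Ω([Jx,Jy], J[u,v]) = g([Jx,Jy], [u,v]). -/
theorem dJd_eq_zero_iff {J : E →L[ℝ] E} {g : E →L[ℝ] E →L[ℝ] ℝ} {Ω : E [⋀^Fin 2]→L[ℝ] ℝ}
    (hcent : ∀ c : E, c 0 = 0 → c 1 = 0 → J c 0 = 0 ∧ J c 1 = 0)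
    (hg : ∀ v w, g v w = g w v) (hΩ : IsFundamentalForm J g Ω) :
    dJd J Ω = 0 ↔ ∀ a b c d, sktForm J g a b c d = 0 := by
  have hβ (u v x y : E) : (extDeriv (invForm Ω) 0).compContinuousLinearMap J ![br u v, x, y] =
      -g (br u v) (br (J x) (J y)) := by
    obtain ⟨h0, h1⟩ := hcent (br u v) rfl rfl
    rw [ContinuousAlternatingMap.compContinuousLinearMap_apply,
      show J ∘ ![br u v, x, y] = ![J (br u v), J x, J y] by
        funext i; fin_cases i <;> rfl, extDeriv_invForm_two, br_central_left h0 h1,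
      br_central_left h0 h1, ← hΩ (br (J x) (J y)) (br u v), Ω.map_coord_zero 0 rfl, Ω.map_coord_zero 0 rfl, hg]
    ring
  have hD (a b c d : E) : extDeriv
      (invForm ((extDeriv (invForm Ω) 0).compContinuousLinearMap J)) 0 ![a, b, c, d] =
        sktForm J g a b c d := by
    rw [extDeriv_invForm_three]
    simp only [hβ, sktForm]
    ring
  rw [dJd_eq_invForm]
  constructor
  · intro h a b c d
    rw [← hD, h]
    rfl
  · intro h
    rw [extDeriv_invForm]
    funext p
    ext v
    rw [invForm_dLeft]
    refine Eq.trans (congrArg _ ?_) ((hD _ _ _ _).trans (h (dLeft (inv p) p (v 0))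
      (dLeft (inv p) p (v 1)) (dLeft (inv p) p (v 2)) (dLeft (inv p) p (v 3))))
    funext i
    fin_cases i <;> rfl

/-! ### Invariance of the centre -/

/-- For central c the Nijenhuis tensor reduces to [Jc,Jw] = J[Jc,w]. If Jc were not central, [Jc,·]
would map onto the centre; choosing w with [Jc,w] = c gives Jc = [Jc,Jw], which is central. -/
theorem apply_central {J : E →L[ℝ] E} (hJ : J ∈ complexStructures) {c : E} (h0 : c 0 = 0)
    (h1 : c 1 = 0) : J c 0 = 0 ∧ J c 1 = 0 := by
  obtain ⟨hsq, hN⟩ := (mem_complexStructures_iff J).1 hJ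
  by_contra hc
  have hcomm (w : E) : br (J c) (J w) = J (br (J c) w) := by
    have h := hN c w
    rwa [br_central_left h0 h1, br_central_left h0 h1, map_zero, sub_zero, sub_zero,
      sub_eq_zero] at h
  have key (w : E) : J (br (J c) w) 0 = 0 ∧ J (br (J c) w) 1 = 0 := by
    rw [← hcomm]
    exact ⟨rfl, rfl⟩
  obtain ⟨w, hw⟩ : ∃ w, br (J c) w = c := by
    by_cases h : J c 0 = 0
    · have h' : J c 1 ≠ 0 := fun h' => hc ⟨h, h'⟩
      refine ⟨![-(c 2 / J c 1), 0, 0], ext_coords (by simp [h0]) (by simp [h1]) ?_⟩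
      simp [mul_div_cancel₀ _ h']
    · refine ⟨![0, c 2 / J c 0, 0], ext_coords (by simp [h0]) (by simp [h1]) ?_⟩
      simp [mul_div_cancel₀ _ h]
  exact hc (hw ▸ key w)

/-! ### Fundamental forms and the SKT condition -/

theorem IsHermitianMetric.apply_left {J : E →L[ℝ] E} {g : E →L[ℝ] E →L[ℝ] ℝ}
    (hg : IsHermitianMetric J g) (hsq : ∀ v, J (J v) = -v) (v w : E) : g (J v) w = -g v (J w) := by
  rw [← hg.orthogonal v, hsq]
  simp

theorem exists_isFundamentalForm {J : E →L[ℝ] E} (hsq : ∀ v, J (J v) = -v)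
    {g : E →L[ℝ] E →L[ℝ] ℝ} (hg : IsHermitianMetric J g) : ∃ Ω, IsFundamentalForm J g Ω := by
  refine ⟨
    { toFun := fun v => -g (v 0) (J (v 1))
      map_update_add' := ?_
      map_update_smul' := ?_
      cont := by fun_prop
      map_eq_zero_of_eq' := ?_ }, fun v w => ?_⟩
  · intro _ m i x y
    fin_cases i <;> simp <;> ring
  · intro _ m i c x
    fin_cases i <;> simp
  · intro v i j hij hne
    have h : v 0 = v 1 := by
      fin_cases i <;> fin_cases j <;> first | exact absurd rfl hne | exact hij | exact hij.symm
    have h1 := hg.apply_left hsq (v 1) (v 1)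
    rw [hg.symm] at h1
    change -g (v 0) (J (v 1)) = 0
    rw [h]
    linarith
  · change g v w = -g v (J (J w))
    simp [hsq]

/-- The condition dΩ ≠ 0 costs nothing: with e = [e₁,e₂] one has dΩ(e₁, e₂, Je) = -Ω(e, Je) =
-g(e,e) < 0, because Je is central. -/
theorem isSKTMetric_iff {J : E →L[ℝ] E} (hJ : J ∈ complexStructures)
    {g : E →L[ℝ] E →L[ℝ] ℝ} (hg : IsHermitianMetric J g) :
    IsSKTMetric J g ↔ ∀ a b c d, sktForm J g a b c d = 0 := by
  have hcent (c : E) (h0 : c 0 = 0) (h1 : c 1 = 0) := apply_central hJ h0 h1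
  constructor
  · rintro ⟨-, Ω, hΩ, h, -⟩
    exact (dJd_eq_zero_iff hcent hg.symm hΩ).1 h
  · intro h
    obtain ⟨Ω, hΩ⟩ := exists_isFundamentalForm hJ.1 hg
    refine ⟨hg, Ω, hΩ, (dJd_eq_zero_iff hcent hg.symm hΩ).2 h, fun h0 => ?_⟩
    let e : E := br ![1, 0, 0] ![0, 1, 0]
    have he : J e 0 = 0 ∧ J e 1 = 0 := hcent e rfl rfl
    have he' (v : E) : br v (J e) = 0 := ext_coords rfl rfl (by simp [he.1, he.2])
    have h1 := extDeriv_invForm_two Ω ![1, 0, 0] ![0, 1, 0] (J e)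
    rw [h0, he', he', Ω.map_coord_zero (m := ![0, _]) 0 rfl,
      Ω.map_coord_zero (m := ![0, _]) 0 rfl, ← hΩ] at h1
    have h2 := hg.pos e fun h => by simpa [e] using congrFun h 2
    have h3 : (0 : ℝ) = -(g e e) := by simpa using h1
    linarith

/-- For an SKT structure, a vector outside the centre does not commute with its image. -/
theorem br_apply_ne_zero {J : E →L[ℝ] E} (hJ : J ∈ complexStructures) (hskt : IsSKT J) {u : E}
    (hu : u 0 ≠ 0 ∨ u 1 ≠ 0) : br u (J u) ≠ 0 := by
  intro hbr
  obtain ⟨g, hg⟩ := hskt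
  have hD := (isSKTMetric_iff hJ hg.1).1 hg
  have hsq := hJ.1
  obtain ⟨v, hv⟩ : ∃ v, br u v ≠ 0 := by
    rcases hu with hu | hu
    · exact ⟨![0, 1, 0], fun h => hu (by simpa using congrFun h 2)⟩
    · exact ⟨![1, 0, 0], fun h => hu (by simpa using congrFun h 2)⟩
  have neg_r (v w : E) : br v (-w) = -br v w :=
    ext_coords (by simp) (by simp) (by simp; ring)
  have neg_l (v w : E) : br (-v) w = -br v w :=
    ext_coords (by simp) (by simp) (by simp; ring)
  have swap (v w : E) : br v w = -br w v :=
    ext_coords (by simp) (by simp) (by simp; ring)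
  have nonneg (v : E) : 0 ≤ g v v := by
    by_cases h : v = 0
    · simp [h]
    · exact (hg.1.pos v h).le
  -- The terms containing [u,Ju] drop out; what is left is minus the sum of the squared norms of
  -- [u,v], [u,Jv], [Ju,v] and [Ju,Jv].
  have h := hD u (J u) v (J v)
  simp only [sktForm, hsq, neg_r, neg_l, swap (J u) u, hbr, neg_zero, map_zero,
    zero_apply, map_neg, neg_neg] at h
  linarith [hg.1.pos _ hv, nonneg (br (J u) (J v)), nonneg (br (J u) v), nonneg (br u (J v))]

local notation "conj" => starRingEnd ℂ

/-! ### Complex structures from coframes -/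

/-- The conjugate of the `i`-th coordinate. -/
noncomputable def conjCoord (i : Fin 3) : E →L[ℝ] ℂ := conjForm (ContinuousLinearMap.proj i)

@[simp] theorem conjCoord_apply (i : Fin 3) (v : E) : conjCoord i v = conj (v i) := rfl

/-- The map with components
`s ω¹ + t (a ω̄¹ + b ω̄²)`, `s ω² + t (c ω̄¹ + d ω̄²)`,
`s² ω³ + t (x ω̄¹ + y ω̄²) - t² det X ω̄³`, where `X = (a b; c d)`. -/
noncomputable def coframe (s t : ℝ) (X : Matrix (Fin 2) (Fin 2) ℂ) (x y : ℂ) : E →L[ℝ] E :=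
  s • ContinuousLinearMap.pi ![ContinuousLinearMap.proj 0, ContinuousLinearMap.proj 1, 0] +
  s ^ 2 • ContinuousLinearMap.pi ![0, 0, -ContinuousLinearMap.proj 2] +
  t • ContinuousLinearMap.pi ![X 0 0 • conjCoord 0 + X 0 1 • conjCoord 1,
    X 1 0 • conjCoord 0 + X 1 1 • conjCoord 1, x • conjCoord 0 + y • conjCoord 1] +
  t ^ 2 • ContinuousLinearMap.pi ![0, 0, X.det • conjCoord 2]

section
variable (s t : ℝ) (X : Matrix (Fin 2) (Fin 2) ℂ) (x y : ℂ) (v : E)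

theorem coframe_apply_zero :
    coframe s t X x y v 0 = s * v 0 + t * (X 0 0 * conj (v 0) + X 0 1 * conj (v 1)) := by
  simp [coframe]
  ring

theorem coframe_apply_one :
    coframe s t X x y v 1 = s * v 1 + t * (X 1 0 * conj (v 0) + X 1 1 * conj (v 1)) := by
  simp [coframe]
  ring

theorem coframe_apply_two :
    coframe s t X x y v 2 =
      -s ^ 2 * v 2 + t * (x * conj (v 0) + y * conj (v 1)) + t ^ 2 * X.det * conj (v 2) := by
  simp [coframe, mul_assoc]
  ring

end

/-- The complex structure for which the components of `A` are of type `(1,0)`. -/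
noncomputable def ofCoframe (A : E →L[ℝ] E) : E →L[ℝ] E := Ring.inverse A * J₀ * A

theorem J₀_apply (v : E) : J₀ v = Complex.I • v := rfl

theorem isUnit_of_injective {A : E →L[ℝ] E} (hA : Function.Injective A) : IsUnit A := by
  rw [ContinuousLinearMap.isUnit_iff_bijective]
  exact ⟨hA, (LinearMap.injective_iff_surjective (f := (A : E →ₗ[ℝ] E))).1 hA⟩

theorem apply_ofCoframe {A : E →L[ℝ] E} (hA : Function.Injective A) (v : E) :
    A (ofCoframe A v) = Complex.I • A v := by
  have h : A * ofCoframe A = J₀ * A := by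
    rw [ofCoframe, ← mul_assoc, ← mul_assoc, Ring.mul_inverse_cancel _ (isUnit_of_injective hA),
      one_mul]
  exact congrArg (fun B : E →L[ℝ] E => B v) h

theorem eq_ofCoframe {A J : E →L[ℝ] E} (hA : Function.Injective A)
    (hJ : ∀ v, A (J v) = Complex.I • A v) : J = ofCoframe A := by
  ext1 v
  exact hA (by rw [hJ, apply_ofCoframe hA])

theorem sq_eq_neg_of_coframe {A J : E →L[ℝ] E} (hA : Function.Injective A)
    (hJ : ∀ v, A (J v) = Complex.I • A v) (v : E) : J (J v) = -v := by
  apply hA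
  rw [hJ, hJ, smul_smul, Complex.I_mul_I, map_neg, neg_one_smul]

/-- Where α¹ = α² = 0 one has s ω = -t X ω̄, hence s² ω¹∧ω² = t² det X ω̄¹∧ω̄². The weights s² and
t² in α³ are chosen so that dα³ vanishes there, which is integrability. -/
theorem mem_complexStructures_of_coframe {s t : ℝ} {X : Matrix (Fin 2) (Fin 2) ℂ} {x y : ℂ}
    {J : E →L[ℝ] E} (hA : Function.Injective (coframe s t X x y))
    (hJ : ∀ v, coframe s t X x y (J v) = Complex.I • coframe s t X x y v) :
    J ∈ complexStructures := by
  rw [mem_complexStructures_iff]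
  refine ⟨sq_eq_neg_of_coframe hA hJ, fun v w => hA ?_⟩
  rw [map_sub, map_sub, map_sub, hJ, hJ, map_zero]
  have e0 (v : E) := congrFun (hJ v) 0
  have e1 (v : E) := congrFun (hJ v) 1
  simp only [coframe_apply_zero, coframe_apply_one, Pi.smul_apply, smul_eq_mul] at e0 e1
  refine ext_coords ?_ ?_ ?_
  · simp [coframe_apply_zero]
  · simp [coframe_apply_one]
  have I2 : Complex.I * Complex.I = -1 := Complex.I_mul_I
  -- `h0` and `h1` say that α¹ and α², extended complex-linearly, kill the (0,1)-vector v + iJv.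
  have h0 (v : E) : s * (v 0 + Complex.I * J v 0) +
      t * (X 0 0 * (conj (v 0) + Complex.I * conj (J v 0)) +
        X 0 1 * (conj (v 1) + Complex.I * conj (J v 1))) = 0 := by
    linear_combination Complex.I * e0 v +
      (s * v 0 + t * (X 0 0 * conj (v 0) + X 0 1 * conj (v 1))) * I2
  have h1 (v : E) : s * (v 1 + Complex.I * J v 1) +
      t * (X 1 0 * (conj (v 0) + Complex.I * conj (J v 0)) +
        X 1 1 * (conj (v 1) + Complex.I * conj (J v 1))) = 0 := by
    linear_combination Complex.I * e1 v +
      (s * v 1 + t * (X 1 0 * conj (v 0) + X 1 1 * conj (v 1))) * I2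
  simp only [Pi.sub_apply, Pi.smul_apply, Pi.zero_apply, coframe_apply_two, br_zero, br_one,
    br_two, map_zero, map_sub, map_mul, smul_eq_mul, Matrix.det_fin_two]
  linear_combination
    s * (w 1 + Complex.I * J w 1) * h0 v -
    t * (X 0 0 * (conj (v 0) + Complex.I * conj (J v 0)) +
        X 0 1 * (conj (v 1) + Complex.I * conj (J v 1))) * h1 w -
    s * (w 0 + Complex.I * J w 0) * h1 v +
    t * (X 1 0 * (conj (v 0) + Complex.I * conj (J v 0)) +
        X 1 1 * (conj (v 1) + Complex.I * conj (J v 1))) * h0 w -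
    (s ^ 2 * (J v 0 * J w 1 - J v 1 * J w 0) - t ^ 2 * (X 0 0 * X 1 1 - X 0 1 * X 1 0) *
      (conj (J v 0) * conj (J w 1) - conj (J v 1) * conj (J w 0))) * I2

/-- The action of `P` on the first two coordinates. -/
def chg (P : Matrix (Fin 2) (Fin 2) ℂ) (v : E) (i : Fin 2) : ℂ := P i 0 * v 0 + P i 1 * v 1

theorem mul_normalForm (P : GL (Fin 2) ℂ) (z : ℂ) :
    P.val * normalForm P z = !![0, z; 1, 0] * P.val.map conj := by
  rw [normalForm, ← mul_assoc, ← mul_assoc, ← Units.val_mul, mul_inv_cancel, Units.val_one, one_mul]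

theorem det_mul_det_normalForm (P : GL (Fin 2) ℂ) (z : ℂ) :
    P.val.det * (normalForm P z).det = -z * conj P.val.det := by
  rw [← Matrix.det_mul, mul_normalForm, Matrix.det_mul]
  simp [Matrix.det_fin_two]

theorem norm_det_normalForm (P : GL (Fin 2) ℂ) (z : ℂ) : ‖(normalForm P z).det‖ = ‖z‖ := by
  have h := congrArg norm (det_mul_det_normalForm P z)
  have hP : ‖P.val.det‖ ≠ 0 := norm_ne_zero_iff.2 (Matrix.isUnits_det_units P).ne_zero
  rw [norm_mul, norm_mul, norm_neg, RCLike.norm_conj, mul_comm] at h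
  exact mul_right_cancel₀ hP h

section
variable (s t : ℝ) (P : GL (Fin 2) ℂ) (z x y : ℂ) (v : E)

theorem chg_coframe_zero : chg P.val (coframe s t (normalForm P z) x y v) 0 =
    s * chg P.val v 0 + t * z * conj (chg P.val v 1) := by
  have h0 := congrFun (congrFun (mul_normalForm P z) 0) 0
  have h1 := congrFun (congrFun (mul_normalForm P z) 0) 1
  simp [Matrix.mul_apply, Fin.sum_univ_two] at h0 h1
  simp only [chg, coframe_apply_zero, coframe_apply_one, map_add, map_mul]
  linear_combination t * conj (v 0) * h0 + t * conj (v 1) * h1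

theorem chg_coframe_one : chg P.val (coframe s t (normalForm P z) x y v) 1 =
    s * chg P.val v 1 + t * conj (chg P.val v 0) := by
  have h0 := congrFun (congrFun (mul_normalForm P z) 1) 0
  have h1 := congrFun (congrFun (mul_normalForm P z) 1) 1
  simp [Matrix.mul_apply, Fin.sum_univ_two] at h0 h1
  simp only [chg, coframe_apply_zero, coframe_apply_one, map_add, map_mul]
  linear_combination t * conj (v 0) * h0 + t * conj (v 1) * h1

end

theorem det_mul_apply_zero (P : Matrix (Fin 2) (Fin 2) ℂ) (v : E) :
    P.det * v 0 = P 1 1 * chg P v 0 - P 0 1 * chg P v 1 := by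
  rw [Matrix.det_fin_two, chg, chg]
  ring

theorem det_mul_apply_one (P : Matrix (Fin 2) (Fin 2) ℂ) (v : E) :
    P.det * v 1 = P 0 0 * chg P v 1 - P 1 0 * chg P v 0 := by
  rw [Matrix.det_fin_two, chg, chg]
  ring

/-- In the coordinates w = P(v⁰,v¹) the first two equations are s w₀ + t z w̄₁ = 0 and s w₁ + t w̄₀
= 0; eliminating w₁ leaves (s² - t² z) w₀ = 0. On the centre, s² v² = t² det X v̄² is excluded by
comparing norms, since |det X| = |z|. The case s = 0 is needed for the path to -J₀. -/
theorem injective_coframe {s t : ℝ} (P : GL (Fin 2) ℂ) {z : ℂ} (x y : ℂ)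
    (h : s ^ 2 ≠ t ^ 2 * ‖z‖) :
    Function.Injective (coframe s t (normalForm P z) x y) := by
  rw [injective_iff_map_eq_zero]
  intro v hv
  have h' : (s : ℂ) ^ 2 ≠ t ^ 2 * z := fun h' => h (by simpa using congrArg norm h')
  have h0 := chg_coframe_zero s t P z x y v
  have h1 := chg_coframe_one s t P z x y v
  have h2 := coframe_apply_two s t (normalForm P z) x y v
  have hP : P.val.det ≠ 0 := (Matrix.isUnits_det_units P).ne_zero
  have hc (i : Fin 2) : chg P.val 0 i = 0 := by simp [chg]
  rw [hv, hc] at h0 h1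
  have h3 := congrArg conj h1
  simp only [map_zero, map_add, map_mul, Complex.conj_ofReal, Complex.conj_conj] at h3
  have w0 : chg P.val v 0 = 0 := by
    have : ((s : ℂ) ^ 2 - t ^ 2 * z) * chg P.val v 0 = 0 := by
      linear_combination -s * h0 + t * z * h3
    exact (mul_eq_zero.1 this).resolve_left (sub_ne_zero.2 h')
  have w1 : chg P.val v 1 = 0 := by
    rw [w0] at h0 h1
    by_cases hs : (s : ℂ) = 0
    · have ht : (t : ℂ) * z ≠ 0 := by
        rintro h0'
        apply h'
        rw [hs]
        linear_combination -t * h0'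
      have : (t : ℂ) * z * conj (chg P.val v 1) = 0 := by linear_combination -h0
      simpa using (mul_eq_zero.1 this).resolve_left ht
    · have : (s : ℂ) * chg P.val v 1 = 0 := by simpa using h1.symm
      exact (mul_eq_zero.1 this).resolve_left hs
  have v0 : v 0 = 0 := by
    have := det_mul_apply_zero P.val v
    rw [w0, w1, mul_zero, mul_zero, sub_zero] at this
    exact (mul_eq_zero.1 this).resolve_left hP
  have v1 : v 1 = 0 := by
    have := det_mul_apply_one P.val v
    rw [w0, w1, mul_zero, mul_zero, sub_zero] at this
    exact (mul_eq_zero.1 this).resolve_left hP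
  refine ext_coords v0 v1 ?_
  rw [v0, v1, hv] at h2
  have h4 : (s : ℂ) ^ 2 * v 2 = t ^ 2 * (normalForm P z).det * conj (v 2) := by
    simp at h2
    linear_combination h2
  have h5 := congrArg norm h4
  simp only [norm_mul, norm_pow, Complex.norm_real, Real.norm_eq_abs, sq_abs, RCLike.norm_conj,
    norm_det_normalForm] at h5
  by_contra hne
  exact h (mul_right_cancel₀ (norm_ne_zero_iff.2 hne) h5)

/-! ### The structures `J_{X,x,y}` -/

theorem Λ_le_oneZeroForms_iff {X : Matrix (Fin 2) (Fin 2) ℂ} {x y : ℂ} {J : E →L[ℝ] E} :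
    Λ X x y ≤ oneZeroForms J ↔
      ∀ v, coframe 1 1 X x y (J v) = Complex.I • coframe 1 1 X x y v := by
  have h0 (v : E) : (ω 0 + X 0 0 • conjForm (ω 0) + X 0 1 • conjForm (ω 1)) v =
      coframe 1 1 X x y v 0 := by
    rw [coframe_apply_zero]
    simp [ω, conjForm]
    ring
  have h1 (v : E) : (ω 1 + X 1 0 • conjForm (ω 0) + X 1 1 • conjForm (ω 1)) v =
      coframe 1 1 X x y v 1 := by
    rw [coframe_apply_one]
    simp [ω, conjForm]
    ring
  have h2 (v : E) : (ω 2 + x • conjForm (ω 0) + y • conjForm (ω 1) +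
      (-X.det) • conjForm (ω 2)) v = coframe 1 1 X x y v 2 := by
    rw [coframe_apply_two]
    simp [ω, conjForm]
    ring
  have hm (α : E →L[ℝ] ℂ) : α ∈ oneZeroForms J ↔ ∀ v, α (J v) = Complex.I * α v := Iff.rfl
  rw [Λ, Submodule.span_le]
  simp only [Set.insert_subset_iff, Set.singleton_subset_iff, SetLike.mem_coe, hm, h0, h1, h2]
  constructor
  · rintro ⟨e0, e1, e2⟩ v
    exact ext_coords (e0 v) (e1 v) (e2 v)
  · intro h
    exact ⟨fun v => congrFun (h v) 0, fun v => congrFun (h v) 1, fun v => congrFun (h v) 2⟩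

theorem coframe_mem_Λ (X : Matrix (Fin 2) (Fin 2) ℂ) (x y : ℂ) (i : Fin 3) :
    (ContinuousLinearMap.proj i : E →L[ℝ] ℂ).comp (coframe 1 1 X x y) ∈ Λ X x y := by
  refine Submodule.subset_span ?_
  simp only [Set.mem_insert_iff, Set.mem_singleton_iff]
  fin_cases i
  · refine Or.inl ?_
    ext v
    simp [coframe_apply_zero, ω, conjForm]
    ring
  · refine Or.inr (Or.inl ?_)
    ext v
    simp [coframe_apply_one, ω, conjForm]
    ring
  · refine Or.inr (Or.inr ?_)
    ext v
    simp [coframe_apply_two, ω, conjForm]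
    ring

/-- An injective coframe A is a real isomorphism carrying J to multiplication by i. A (1,0)-form
composed with A⁻¹ is therefore complex-linear, hence a combination of the components of A; this
gives equality of spaces and not just inclusion. -/
theorem isJ_iff {X : Matrix (Fin 2) (Fin 2) ℂ} {x y : ℂ} {J : E →L[ℝ] E}
    (hA : Function.Injective (coframe 1 1 X x y)) :
    IsJ X x y J ↔ ∀ v, coframe 1 1 X x y (J v) = Complex.I • coframe 1 1 X x y v := by
  refine ⟨fun h => Λ_le_oneZeroForms_iff.1 h.2.ge, fun h => ⟨sq_eq_neg_of_coframe hA h,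
    le_antisymm (fun α hα => ?_) (Λ_le_oneZeroForms_iff.2 h)⟩⟩
  have hα : ∀ v, α (J v) = Complex.I * α v := hα
  obtain ⟨B, hB⟩ := (isUnit_of_injective hA).exists_right_inv
  replace hB (v : E) : coframe 1 1 X x y (B v) = v :=
    congrArg (fun C : E →L[ℝ] E => C v) hB
  have hBI (v : E) : B (Complex.I • v) = J (B v) := hA (by rw [hB, h, hB])
  have hsmul (c : ℂ) (v : E) : α (B (c • v)) = c * α (B v) := by
    have hc : c • v = c.re • v + c.im • Complex.I • v := by
      rw [← Complex.coe_smul, ← Complex.coe_smul, smul_smul, ← add_smul, Complex.re_add_im]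
    rw [hc, map_add, map_add, map_smul, map_smul, map_smul, map_smul, hBI, hα,
      ← Complex.coe_smul, ← Complex.coe_smul, smul_eq_mul, smul_eq_mul]
    nth_rw 3 [← Complex.re_add_im c]
    ring
  have hsum : α = ∑ i, α (B (Pi.single i 1)) •
      (ContinuousLinearMap.proj i : E →L[ℝ] ℂ).comp (coframe 1 1 X x y) := by
    ext v
    have hv : α v = α (B (coframe 1 1 X x y v)) := congrArg α (hA (by rw [hB]))
    rw [hv]
    conv_lhs => rw [pi_eq_sum_univ' (coframe 1 1 X x y v)]
    simp only [map_sum, hsmul, sum_apply, smul_apply, smul_eq_mul, ContinuousLinearMap.comp_apply,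
      ContinuousLinearMap.proj_apply]
    refine Finset.sum_congr rfl fun i _ => ?_
    rw [mul_comm]
  rw [hsum]
  exact Submodule.sum_mem _ fun i _ => Submodule.smul_mem _ _ (coframe_mem_Λ X x y i)

/-! ### The SKT condition for the normal form -/

/-- A `2 × 2` minor. -/
def minor (a b : Fin 2 → ℂ) : ℂ := a 0 * b 1 - a 1 * b 0

/-- The determinant of the vectors `(a, ā)`, …, `(d, d̄)`, by Laplace expansion. -/
noncomputable def volForm (a b c d : Fin 2 → ℂ) : ℂ :=
  minor a b * conj (minor c d) - minor a c * conj (minor b d) + minor a d * conj (minor b c) +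
    minor b c * conj (minor a d) - minor b d * conj (minor a c) + minor c d * conj (minor a b)

/-- The 2-form `dα³` of the normal form in terms of the `(1,0)`-forms `α¹`, `α²`, up to a factor. -/
noncomputable def torsion (z : ℂ) (a b : Fin 2 → ℂ) : ℂ :=
  (1 - z * conj z) * (a 0 * b 1 - a 1 * b 0) + (z - 1) * (a 0 * conj (b 0) - conj (a 0) * b 0) +
    z * (1 - conj z) * (a 1 * conj (b 1) - conj (a 1) * b 1)

/-- The expression whose vanishing is the equation of the curve. -/
noncomputable def curveEq (z : ℂ) : ℂ :=
  8 * (z * conj z) - (1 + z * conj z) * ((1 + z) * (1 + conj z))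

theorem curveEq_eq (z : ℂ) :
    curveEq z = ((8 * ‖z‖ ^ 2 - (1 + ‖z‖ ^ 2) * ‖1 + z‖ ^ 2 : ℝ) : ℂ) := by
  push_cast
  rw [← Complex.mul_conj', ← Complex.mul_conj', curveEq, map_add, map_one]

theorem curveEq_eq_zero_iff (z : ℂ) :
    curveEq z = 0 ↔ (1 + ‖z‖ ^ 2) * ‖1 + z‖ ^ 2 = 8 * ‖z‖ ^ 2 := by
  rw [curveEq_eq, Complex.ofReal_eq_zero, sub_eq_zero, eq_comm]

/-- Multiplying two arguments by i negates the (2,0) part and fixes the (1,1) part. So the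
coefficient is -(1-|z|²)² - 2 Re(z̄(z-1)²), from the square of the (2,0) coefficient and the product
of the two (1,1) coefficients; it expands to `curveEq z`. -/
theorem torsion_splitting (z : ℂ) (a b c d : Fin 2 → ℂ) :
    torsion z a b * conj (torsion z (Complex.I • c) (Complex.I • d)) -
      torsion z a c * conj (torsion z (Complex.I • b) (Complex.I • d)) +
      torsion z a d * conj (torsion z (Complex.I • b) (Complex.I • c)) +
      torsion z b c * conj (torsion z (Complex.I • a) (Complex.I • d)) -
      torsion z b d * conj (torsion z (Complex.I • a) (Complex.I • c)) +
      torsion z c d * conj (torsion z (Complex.I • a) (Complex.I • b)) =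
    curveEq z * volForm a b c d := by
  have hI (a b : Fin 2 → ℂ) : conj (torsion z (Complex.I • a) (Complex.I • b)) =
      -(1 - conj z * z) * (conj (a 0) * conj (b 1) - conj (a 1) * conj (b 0)) +
      (conj z - 1) * (conj (a 0) * b 0 - a 0 * conj (b 0)) +
      conj z * (1 - z) * (conj (a 1) * b 1 - a 1 * conj (b 1)) := by
    simp only [torsion, Pi.smul_apply, smul_eq_mul, map_add, map_sub, map_mul, map_one,
      map_neg, Complex.conj_conj, Complex.conj_I]
    linear_combination ((1 - conj z * z) * (conj (a 0) * conj (b 1) - conj (a 1) * conj (b 0)) -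
      (conj z - 1) * (conj (a 0) * b 0 - a 0 * conj (b 0)) -
      conj z * (1 - z) * (conj (a 1) * b 1 - a 1 * conj (b 1))) * Complex.I_mul_I
  simp only [hI]
  simp only [torsion, curveEq, volForm, minor, map_sub, map_mul]
  ring

section
variable {P : GL (Fin 2) ℂ} {z x y : ℂ} {J : E →L[ℝ] E}

theorem chg_smul (P : Matrix (Fin 2) (Fin 2) ℂ) (c : ℂ) (v : E) :
    chg P (c • v) = c • chg P v := by
  funext i
  simp only [chg, Pi.smul_apply, smul_eq_mul]
  ring

theorem minor_chg (P : Matrix (Fin 2) (Fin 2) ℂ) (v w : E) :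
    minor (chg P v) (chg P w) = P.det * br v w 2 := by
  simp only [minor, chg, Matrix.det_fin_two, br_two]
  ring

/-- This is dα³(v,w) = -α³([v,w]) rewritten in α¹, α²; the factor |1-z|² det P clears denominators
and is nonzero exactly when z ≠ 1. -/
theorem torsion_chg (P : GL (Fin 2) ℂ) (z x y : ℂ) (v w : E) :
    torsion z (chg P.val (coframe 1 1 (normalForm P z) x y v))
      (chg P.val (coframe 1 1 (normalForm P z) x y w)) =
    -((1 - z) * (1 - conj z) * P.val.det) * coframe 1 1 (normalForm P z) x y (br v w) 2 := by
  have h := minor_chg P.val v w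
  have h' := congrArg conj h
  have hd := det_mul_det_normalForm P z
  rw [coframe_apply_two]
  simp only [torsion, chg_coframe_zero, chg_coframe_one]
  simp only [minor, map_add, map_sub, map_mul, Complex.conj_conj, Complex.ofReal_one, br_zero,
    br_one, map_zero, map_one, mul_zero] at h h' ⊢
  linear_combination (1 - z) * (1 - conj z) * h + (1 - z) * (1 - conj z) * z * h' +
    (1 - z) * (1 - conj z) * conj (br v w 2) * hd

/-- The centre is the complex line spanned by e and Je, which are orthogonal of equal length, and α³
is a complex coordinate on it. A Hermitian metric on a complex line is unique up to scale. -/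
theorem metric_centre {A J : E →L[ℝ] E} (hA : Function.Injective A)
    (hA0 : ∀ c : E, c 0 = 0 → c 1 = 0 → A c 0 = 0 ∧ A c 1 = 0)
    (hJ : ∀ v, A (J v) = Complex.I • A v)
    {g : E →L[ℝ] E →L[ℝ] ℝ} (hg : IsHermitianMetric J g) :
    ∃ k : ℝ, 0 < k ∧ ∀ c c' : E, c 0 = 0 → c 1 = 0 → c' 0 = 0 → c' 1 = 0 →
      g c c' = k * (A c 2 * conj (A c' 2)).re := by
  let e : E := ![0, 0, 1]
  have he : e ≠ 0 := fun h => by simpa [e] using congrFun h 2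
  obtain ⟨e0, e1⟩ := hA0 e rfl rfl
  have hq : A e 2 ≠ 0 := fun h => he (hA (by rw [map_zero]; exact ext_coords e0 e1 h))
  have hsq := sq_eq_neg_of_coframe hA hJ
  have hdec (c : E) (c0 : c 0 = 0) (c1 : c 1 = 0) :
      c = (A c 2 / A e 2).re • e + (A c 2 / A e 2).im • J e := by
    apply hA
    obtain ⟨d0, d1⟩ := hA0 c c0 c1
    rw [map_add, map_smul, map_smul, hJ]
    refine ext_coords ?_ ?_ ?_
    · simp [d0, e0]
    · simp [d1, e1]
    · simp only [Pi.add_apply, Pi.smul_apply, Complex.real_smul, smul_eq_mul]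
      rw [← mul_assoc, ← add_mul, Complex.re_add_im, div_mul_cancel₀ _ hq]
  have h1 : g e (J e) = 0 := by
    have h1 := hg.apply_left hsq e e
    rw [hg.symm] at h1
    linarith
  have h2 : g (J e) e = 0 := by rw [hg.symm, h1]
  have h3 : g (J e) (J e) = g e e := hg.orthogonal e e
  refine ⟨g e e / Complex.normSq (A e 2), div_pos (hg.pos e he) (Complex.normSq_pos.2 hq),
    fun c c' c0 c1 c0' c1' => ?_⟩
  have h4 : g c c' = g e e * (A c 2 / A e 2 * conj (A c' 2 / A e 2)).re := by
    conv_lhs => rw [hdec c c0 c1, hdec c' c0' c1']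
    simp only [map_add, map_smul, add_apply, smul_apply, smul_eq_mul, h1, h2, h3,
      Complex.mul_re, Complex.conj_re, Complex.conj_im]
    ring
  have h5 : A c 2 / A e 2 * conj (A c' 2 / A e 2) =
      A c 2 * conj (A c' 2) / (Complex.normSq (A e 2) : ℂ) := by
    rw [map_div₀, div_mul_div_comm, Complex.mul_conj (A e 2)]
  rw [h4, h5, Complex.div_ofReal_re]
  ring

theorem sktForm_normalForm (hz1 : z ≠ 1) (hz : ‖z‖ ≠ 1)
    (hJ : ∀ v, coframe 1 1 (normalForm P z) x y (J v) =
      Complex.I • coframe 1 1 (normalForm P z) x y v)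
    {g : E →L[ℝ] E →L[ℝ] ℝ} (hg : IsHermitianMetric J g) :
    ∃ k : ℝ, 0 < k ∧ ∀ a b c d, sktForm J g a b c d = k * (curveEq z * volForm
      (chg P.val (coframe 1 1 (normalForm P z) x y a))
      (chg P.val (coframe 1 1 (normalForm P z) x y b))
      (chg P.val (coframe 1 1 (normalForm P z) x y c))
      (chg P.val (coframe 1 1 (normalForm P z) x y d))).re := by
  have hA : Function.Injective (coframe 1 1 (normalForm P z) x y) :=
    injective_coframe P x y (by simpa using hz.symm)
  obtain ⟨k, hk, hgk⟩ := metric_centre hA (fun c h0 h1 => by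
    simp [coframe_apply_zero, coframe_apply_one, h0, h1]) hJ hg
  have hT := torsion_chg P z x y
  have hJ' (v : E) : chg P.val (coframe 1 1 (normalForm P z) x y (J v)) =
      Complex.I • chg P.val (coframe 1 1 (normalForm P z) x y v) := by rw [hJ, chg_smul]
  generalize coframe 1 1 (normalForm P z) x y = A at *
  set m : ℂ := -((1 - z) * (1 - conj z) * P.val.det) with hm
  have hm0 : m ≠ 0 := by
    have h1 : 1 - z ≠ 0 := sub_ne_zero.2 hz1.symm
    have h2 : 1 - conj z ≠ 0 := by simpa using (map_ne_zero conj).2 h1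
    exact neg_ne_zero.2 (mul_ne_zero (mul_ne_zero h1 h2) (Matrix.isUnits_det_units P).ne_zero)
  have hgT (u v u' v' : E) : g (br u v) (br (J u') (J v')) = k / Complex.normSq m *
      (torsion z (chg P.val (A u)) (chg P.val (A v)) *
        conj (torsion z (Complex.I • chg P.val (A u')) (Complex.I • chg P.val (A v')))).re := by
    rw [hgk _ _ rfl rfl rfl rfl, ← hJ', ← hJ', hT, hT, map_mul, mul_mul_mul_comm,
      Complex.mul_conj m, Complex.re_ofReal_mul]
    have : Complex.normSq m ≠ 0 := (Complex.normSq_pos.2 hm0).ne'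
    field_simp
  refine ⟨k / Complex.normSq m, div_pos hk (Complex.normSq_pos.2 hm0), fun a b c d => ?_⟩
  rw [← torsion_splitting]
  simp only [sktForm, hgT, Complex.add_re, Complex.sub_re]
  ring

theorem sktForm_eq_zero_iff (hz1 : z ≠ 1) (hz : ‖z‖ ≠ 1)
    (hJ : ∀ v, coframe 1 1 (normalForm P z) x y (J v) =
      Complex.I • coframe 1 1 (normalForm P z) x y v)
    {g : E →L[ℝ] E →L[ℝ] ℝ} (hg : IsHermitianMetric J g) :
    (∀ a b c d, sktForm J g a b c d = 0) ↔ z ∈ curve := by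
  obtain ⟨k, hk, h⟩ := sktForm_normalForm hz1 hz hJ hg
  have hc : z ∈ curve ↔ curveEq z = 0 := by
    rw [curveEq_eq_zero_iff]
    exact and_iff_left hz1
  rw [hc]
  refine ⟨fun h0 => ?_, fun hz a b c d => by simp [h, hz]⟩
  have hA : Function.Injective (coframe 1 1 (normalForm P z) x y) :=
    injective_coframe P x y (by simpa using hz.symm)
  have hsurj := ((ContinuousLinearMap.isUnit_iff_bijective).1 (isUnit_of_injective hA)).2
  have hP : P.val.det ≠ 0 := (Matrix.isUnits_det_units P).ne_zero
  -- The columns of P⁻¹ are used, so that u and v have standard basis vectors as P-coordinates; on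
  -- u, Ju, v, Jv the volume form equals 4.
  obtain ⟨u, hu⟩ := hsurj ![P.val 1 1 / P.val.det, -P.val 1 0 / P.val.det, 0]
  obtain ⟨v, hv⟩ := hsurj ![-P.val 0 1 / P.val.det, P.val 0 0 / P.val.det, 0]
  have cu : chg P.val (coframe 1 1 (normalForm P z) x y u) = ![1, 0] := by
    rw [hu]
    funext i
    fin_cases i <;> simp [chg] <;> field_simp
    · rw [Matrix.det_fin_two]
      ring
    · ring
  have cv : chg P.val (coframe 1 1 (normalForm P z) x y v) = ![0, 1] := by
    rw [hv]
    funext i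
    fin_cases i <;> simp [chg] <;> field_simp
    · ring
    · rw [Matrix.det_fin_two]
      ring
  have h1 := h u (J u) v (J v)
  rw [h0, hJ, hJ, chg_smul, chg_smul, cu, cv] at h1
  have h2 : volForm ![1, 0] (Complex.I • ![1, 0]) ![0, 1] (Complex.I • ![0, 1]) = 4 := by
    simp [volForm, minor]
    norm_num
  have h3 : (curveEq z).re = 0 := by
    rw [h2] at h1
    have h4 := (mul_eq_zero.1 h1.symm).resolve_left hk.ne'
    simpa using h4
  rw [curveEq_eq] at h3 ⊢
  rw [Complex.ofReal_re] at h3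
  rw [h3, Complex.ofReal_zero]

end

/-! ### Reduction of SKT structures to the normal form -/

theorem exists_coeffs (f : E →L[ℝ] ℂ) :
    ∃ p q : Fin 3 → ℂ, ∀ v, f v = (p 0 * v 0 + p 1 * v 1 + p 2 * v 2) +
      (q 0 * conj (v 0) + q 1 * conj (v 1) + q 2 * conj (v 2)) := by
  let e (i : Fin 3) : E := Pi.single i 1
  refine ⟨fun i => (f (e i) - Complex.I * f (Complex.I • e i)) / 2,
    fun i => (f (e i) + Complex.I * f (Complex.I • e i)) / 2, fun v => ?_⟩
  have hv : v = ((v 0).re • e 0 + (v 0).im • Complex.I • e 0) +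
      ((v 1).re • e 1 + (v 1).im • Complex.I • e 1) +
      ((v 2).re • e 2 + (v 2).im • Complex.I • e 2) := by
    refine ext_coords ?_ ?_ ?_ <;> simp [e, Complex.re_add_im]
  have h (i : Fin 3) : (f (e i) - Complex.I * f (Complex.I • e i)) / 2 * v i +
      (f (e i) + Complex.I * f (Complex.I • e i)) / 2 * conj (v i) =
        (v i).re * f (e i) + (v i).im * f (Complex.I • e i) := by
    have hconj : conj (v i) = (v i).re - (v i).im * Complex.I := by
      apply Complex.ext <;> simp
    rw [hconj]
    nth_rw 1 [← Complex.re_add_im (v i)]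
    linear_combination - ((v i).im : ℂ) * f (Complex.I • e i) * Complex.I_mul_I
  conv_lhs => rw [hv]
  simp only [map_add, map_smul, Complex.real_smul]
  linear_combination -h 0 - h 1 - h 2

/-- An SKT structure has no `(1,0)`-form `λ π + κ π̄` where `π` is a combination of `ω¹`, `ω²`. -/
theorem not_oneZero_of_isSKT {J : E →L[ℝ] E} (hJ : J ∈ complexStructures) (hskt : IsSKT J)
    {p₀ p₁ l k : ℂ} (hp : p₀ ≠ 0 ∨ p₁ ≠ 0) (hlk : l ≠ 0 ∨ k ≠ 0)
    (h : ∀ v, l * (p₀ * J v 0 + p₁ * J v 1) + k * conj (p₀ * J v 0 + p₁ * J v 1) =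
      Complex.I * (l * (p₀ * v 0 + p₁ * v 1) + k * conj (p₀ * v 0 + p₁ * v 1))) : False := by
  let u : E := ![-p₁, p₀, 0]
  -- If |l| = |k|, the form lπ + kπ̄ is proportional to its conjugate, so it is of both types and
  -- vanishes; hence π = 0. Here π = p₀ω¹ + p₁ω².
  by_cases hn : l * conj l = k * conj k
  · have hl : l ≠ 0 := by
      rintro rfl
      have : k = 0 := by simpa using hn
      simp [this] at hlk
    have key (v : E) : l * (p₀ * v 0 + p₁ * v 1) + k * conj (p₀ * v 0 + p₁ * v 1) = 0 := by
      have h1 := h v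
      have h2 := congrArg conj h1
      simp only [map_add, map_mul, Complex.conj_conj, Complex.conj_I] at h1 h2 ⊢
      have hk : k ≠ 0 := by
        rintro rfl
        simp [hl] at hn
      have h3 : 2 * Complex.I * conj k *
          (l * (p₀ * v 0 + p₁ * v 1) +
            k * (conj p₀ * conj (v 0) + conj p₁ * conj (v 1))) = 0 := by
        linear_combination -conj k * h1 + l * h2 +
          (-(conj p₀ * conj (J v 0) + conj p₁ * conj (J v 1)) -
            Complex.I * (conj p₀ * conj (v 0) + conj p₁ * conj (v 1))) * hn
      have hk' : conj k ≠ 0 := (map_ne_zero conj).2 hk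
      have h4 : 2 * Complex.I * conj k ≠ 0 :=
        mul_ne_zero (mul_ne_zero two_ne_zero Complex.I_ne_zero) hk'
      exact (mul_eq_zero.1 h3).resolve_left h4
    have lin (v : E) : p₀ * v 0 + p₁ * v 1 = 0 := by
      have h1 := key v
      have h2 := key (Complex.I • v)
      simp only [map_add, map_mul, Complex.conj_I, Pi.smul_apply, smul_eq_mul] at h1 h2
      have h3 : 2 * l * (p₀ * v 0 + p₁ * v 1) = 0 := by
        linear_combination h1 - Complex.I * h2 +
          (l * (p₀ * v 0 + p₁ * v 1) -
            k * (conj p₀ * conj (v 0) + conj p₁ * conj (v 1))) * Complex.I_mul_I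
      exact (mul_eq_zero.1 h3).resolve_left (mul_ne_zero two_ne_zero hl)
    have h0 := lin ![1, 0, 0]
    have h1 := lin ![0, 1, 0]
    simp at h0 h1
    simp [h0, h1] at hp
  -- If |l| ≠ |k|, then π(u) = 0 forces π(Ju) = 0. Modulo the centre ker π is a complex line, so u
  -- and Ju commute.
  · refine br_apply_ne_zero hJ hskt (u := u) (by simpa [u, or_comm] using hp) ?_
    have h1 := h u
    have h2 := congrArg conj h1
    have hu : p₀ * u 0 + p₁ * u 1 = 0 := by
      simp [u]
      ring
    rw [hu] at h1 h2
    simp only [map_add, map_mul, map_zero, Complex.conj_conj, mul_zero, add_zero] at h1 h2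
    have h3 : (l * conj l - k * conj k) * (p₀ * J u 0 + p₁ * J u 1) = 0 := by
      linear_combination conj l * h1 - k * h2
    refine ext_coords rfl rfl ?_
    have h4 := (mul_eq_zero.1 h3).resolve_left (sub_ne_zero.2 hn)
    simp [u]
    linear_combination -h4

theorem exists_coframe {J : E →L[ℝ] E} (hJ : J ∈ complexStructures) (hskt : IsSKT J) :
    ∃ (X : Matrix (Fin 2) (Fin 2) ℂ) (x y : ℂ),
      ∀ v, coframe 1 1 X x y (J v) = Complex.I • coframe 1 1 X x y v := by
  obtain ⟨hsq, hN⟩ := (mem_complexStructures_iff J).1 hJ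
  have hc (c : E) (h0 : c 0 = 0) (h1 : c 1 = 0) := apply_central hJ h0 h1
  have I2 : Complex.I * Complex.I = -1 := Complex.I_mul_I
  -- The forms βⁱ(v) = vⁱ - i(Jv)ⁱ are of type (1,0); the first two vanish on the centre. They are
  -- split into complex-linear and antilinear parts.
  have hco (i : Fin 3) : ∃ p q : Fin 3 → ℂ, ∀ v : E, v i - Complex.I * J v i =
      (p 0 * v 0 + p 1 * v 1 + p 2 * v 2) +
      (q 0 * conj (v 0) + q 1 * conj (v 1) + q 2 * conj (v 2)) := by
    obtain ⟨p, q, h⟩ := exists_coeffs ((ContinuousLinearMap.proj i : E →L[ℝ] ℂ) -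
      Complex.I • (ContinuousLinearMap.proj i : E →L[ℝ] ℂ).comp J)
    exact ⟨p, q, fun v => by simpa using h v⟩
  have hco' (i : Fin 3) (hi : ∀ c : E, c 0 = 0 → c 1 = 0 → c i - Complex.I * J c i = 0) :
      ∃ p q : Fin 2 → ℂ, ∀ v : E, v i - Complex.I * J v i =
      (p 0 * v 0 + p 1 * v 1) + (q 0 * conj (v 0) + q 1 * conj (v 1)) := by
    obtain ⟨p, q, h⟩ := hco i
    have h1 := (h ![0, 0, 1]).symm.trans (hi _ rfl rfl)
    have h2 := (h ![0, 0, Complex.I]).symm.trans (hi _ rfl rfl)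
    simp at h1 h2
    have hp : p 2 = 0 := by linear_combination (h1 - Complex.I * h2 + (p 2 - q 2) * I2) / 2
    have hq : q 2 = 0 := by linear_combination h1 - hp
    exact ⟨![p 0, p 1], ![q 0, q 1], fun v => by simpa [hp, hq] using h v⟩
  obtain ⟨p, q, h0⟩ := hco' 0 fun c c0 c1 => by simp [c0, (hc c c0 c1).1]
  obtain ⟨p', q', h1⟩ := hco' 1 fun c c0 c1 => by simp [c1, (hc c c0 c1).2]
  obtain ⟨n, r, h2⟩ := hco 2
  have hβ (i : Fin 3) (v : E) : J v i - Complex.I * J (J v) i =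
      Complex.I * (v i - Complex.I * J v i) := by
    rw [hsq, Pi.neg_apply]
    linear_combination J v i * I2
  set D : ℂ := p 0 * p' 1 - p 1 * p' 0 with hD
  -- If D = 0, some combination of the first two βⁱ is purely antilinear, hence an excluded
  -- (1,0)-form. If that combination is zero, the conjugate of the same combination of ω¹, ω² is of
  -- type (1,0), also excluded.
  have hD0 : D ≠ 0 := by
    intro hD0
    obtain ⟨c, c', hcc, e0, e1⟩ : ∃ c c' : ℂ, (c ≠ 0 ∨ c' ≠ 0) ∧ c * p 0 + c' * p' 0 = 0 ∧
        c * p 1 + c' * p' 1 = 0 := by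
      by_cases hp : p 0 = 0 ∧ p' 0 = 0
      · by_cases hp' : p 1 = 0 ∧ p' 1 = 0
        · exact ⟨1, 0, by simp, by simp [hp], by simp [hp']⟩
        · exact ⟨p' 1, -p 1, by simpa [or_comm, imp_iff_or_not] using not_and_or.1 hp', by simp [hp],
            by ring⟩
      · exact ⟨p' 0, -p 0, by simpa [or_comm, imp_iff_or_not] using not_and_or.1 hp, by ring,
          by linear_combination -hD0⟩
    have hf (v : E) : c * (v 0 - Complex.I * J v 0) + c' * (v 1 - Complex.I * J v 1) =
        conj (conj (c * q 0 + c' * q' 0) * v 0 + conj (c * q 1 + c' * q' 1) * v 1) := by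
      rw [h0, h1]
      simp only [map_add, map_mul, Complex.conj_conj]
      linear_combination v 0 * e0 + v 1 * e1
    by_cases hq : c * q 0 + c' * q' 0 = 0 ∧ c * q 1 + c' * q' 1 = 0
    · refine not_oneZero_of_isSKT hJ hskt (l := 0) (k := 1) hcc (Or.inr one_ne_zero) fun v => ?_
      have h := congrArg conj (hf v)
      simp only [hq.1, hq.2, map_add, map_mul, map_sub, map_zero, zero_mul, add_zero,
        Complex.conj_I] at h ⊢
      linear_combination -Complex.I * h + (conj c * conj (J v 0) + conj c' * conj (J v 1)) * I2
    · refine not_oneZero_of_isSKT hJ hskt (l := 0) (k := 1)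
        (p₀ := conj (c * q 0 + c' * q' 0)) (p₁ := conj (c * q 1 + c' * q' 1))
        (by rwa [map_ne_zero, map_ne_zero, ← not_and_or]) (Or.inr one_ne_zero) fun v => ?_
      rw [zero_mul, zero_mul, zero_add, zero_add, one_mul, one_mul, ← hf, ← hf, hβ, hβ]
      ring
  -- D is the ω¹∧ω² coefficient of the wedge of the first two βⁱ, recovered from its values on (e₁
  -- or ie₁, e₂ or ie₂).
  have hδ : ∃ v w : E, (v 0 - Complex.I * J v 0) * (w 1 - Complex.I * J w 1) -
      (v 1 - Complex.I * J v 1) * (w 0 - Complex.I * J w 0) ≠ 0 := by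
    by_contra! hcon
    apply hD0
    have k0 := hcon ![1, 0, 0] ![0, 1, 0]
    have k1 := hcon ![1, 0, 0] ![0, Complex.I, 0]
    have k2 := hcon ![Complex.I, 0, 0] ![0, 1, 0]
    have k3 := hcon ![Complex.I, 0, 0] ![0, Complex.I, 0]
    rw [h0, h0, h1, h1] at k0 k1 k2 k3
    simp at k0 k1 k2 k3
    have k1' := mul_left_cancel₀ Complex.I_ne_zero (a := Complex.I) (b :=
      (p 0 + q 0) * (p' 1 - q' 1) - (p' 0 + q' 0) * (p 1 - q 1)) (c := 0)
      (by linear_combination k1)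
    have k2' := mul_left_cancel₀ Complex.I_ne_zero (a := Complex.I) (b :=
      (p 0 - q 0) * (p' 1 + q' 1) - (p' 0 - q' 0) * (p 1 + q 1)) (c := 0)
      (by linear_combination k2)
    have k3' := mul_left_cancel₀ (mul_ne_zero Complex.I_ne_zero Complex.I_ne_zero)
      (a := Complex.I * Complex.I) (b :=
      (p 0 - q 0) * (p' 1 - q' 1) - (p' 0 - q' 0) * (p 1 - q 1)) (c := 0)
      (by linear_combination k3)
    linear_combination (k0 + k1' + k2' + k3') / 4
  obtain ⟨v, w, hvw⟩ := hδ
  have hN2 : (J v 0 * J w 1 - J v 1 * J w 0) - J (br (J v) w) 2 - J (br v (J w)) 2 -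
      (v 0 * w 1 - v 1 * w 0) = 0 := congrFun (hN v w) 2
  -- If `n 2 = 0`, then J acts as -i on the centre, and N(v,w) = 0 says precisely that the wedge in
  -- `hvw` vanishes.
  have hn : n 2 ≠ 0 := by
    intro hn
    have hr : r 2 = 0 := by
      by_contra hr
      obtain ⟨c0, c1⟩ := hc ![0, 0, 1] rfl rfl
      have k0 := h2 ![0, 0, 1]
      have k1 := hβ 2 ![0, 0, 1]
      rw [h2, c0, c1] at k1
      simp [hn] at k0 k1
      rw [k0, mul_comm] at k1
      have k2 : conj (J ![0, 0, 1] 2) = Complex.I := mul_right_cancel₀ hr k1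
      have k3 := congrArg conj k2
      rw [Complex.conj_conj, Complex.conj_I] at k3
      rw [k3] at k0
      exact hr (by linear_combination -k0 + I2)
    have k1 := h2 (br (J v) w)
    have k2 := h2 (br v (J w))
    simp [hn, hr] at k1 k2
    apply hvw
    linear_combination -hN2 - Complex.I * k1 - Complex.I * k2 +
      ((J v 0 * J w 1 - J v 1 * J w 0) - J (br (J v) w) 2 - J (br v (J w)) 2) * I2
  -- The inverse of the matrix (p; p') applied to (q; q'), normalising the first two βⁱ to α¹ and
  -- α².
  let X : Matrix (Fin 2) (Fin 2) ℂ :=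
    !![(p' 1 * q 0 - p 1 * q' 0) / D, (p' 1 * q 1 - p 1 * q' 1) / D;
      (p 0 * q' 0 - p' 0 * q 0) / D, (p 0 * q' 1 - p' 0 * q 1) / D]
  have hα0 (v : E) : v 0 + (X 0 0 * conj (v 0) + X 0 1 * conj (v 1)) =
      (p' 1 * (v 0 - Complex.I * J v 0) - p 1 * (v 1 - Complex.I * J v 1)) / D := by
    rw [h0, h1]
    simp [X]
    field_simp
    rw [hD]
    ring
  have hα1 (v : E) : v 1 + (X 1 0 * conj (v 0) + X 1 1 * conj (v 1)) =
      (p 0 * (v 1 - Complex.I * J v 1) - p' 0 * (v 0 - Complex.I * J v 0)) / D := by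
    rw [h0, h1]
    simp [X]
    field_simp
    rw [hD]
    ring
  have hV0 (v : E) : v 0 + Complex.I * J v 0 =
      -(X 0 0 * conj (v 0 - Complex.I * J v 0) + X 0 1 * conj (v 1 - Complex.I * J v 1)) := by
    have k := hα0 (J v)
    rw [hβ, hβ] at k
    simp only [map_sub, map_mul, Complex.conj_I]
    linear_combination hα0 v + Complex.I * k +
      (p' 1 * (v 0 - Complex.I * J v 0) - p 1 * (v 1 - Complex.I * J v 1)) / D * I2
  have hV1 (v : E) : v 1 + Complex.I * J v 1 =
      -(X 1 0 * conj (v 0 - Complex.I * J v 0) + X 1 1 * conj (v 1 - Complex.I * J v 1)) := by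
    have k := hα1 (J v)
    rw [hβ, hβ] at k
    simp only [map_sub, map_mul, Complex.conj_I]
    linear_combination hα1 v + Complex.I * k +
      (p 0 * (v 1 - Complex.I * J v 1) - p' 0 * (v 0 - Complex.I * J v 0)) / D * I2
  -- By integrability the third form β vanishes on the bracket of the (0,1)-vectors V = v + iJv and
  -- W = w + iJw. By `hV0` and `hV1` the minor of V, W is det X times that of their conjugates,
  -- which is nonzero by `hvw`.
  have hdet : n 2 * X.det + r 2 = 0 := by
    have t1 := h2 (br (J v) (J w))
    have t2 := h2 (br v w)
    have t3 := h2 (br (J v) w)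
    have t4 := h2 (br v (J w))
    have t5 := hβ 2 (br (J v) w)
    have t6 := hβ 2 (br v (J w))
    have hNJ := congrArg (fun c => J c 2) (hN v w)
    simp only [map_sub, map_zero, Pi.sub_apply, Pi.zero_apply] at hNJ
    have hne := (map_ne_zero conj).2 hvw
    refine (mul_eq_zero.1 (?_ : _ * conj _ = 0)).resolve_right hne
    simp only [br_zero, br_one, br_two, map_zero, mul_zero, zero_add, map_sub, map_mul]
      at t1 t2 t3 t4 t5 t6
    have hdetV : (v 0 + Complex.I * J v 0) * (w 1 + Complex.I * J w 1) -
        (v 1 + Complex.I * J v 1) * (w 0 + Complex.I * J w 0) =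
        X.det * conj ((v 0 - Complex.I * J v 0) * (w 1 - Complex.I * J w 1) -
      (v 1 - Complex.I * J v 1) * (w 0 - Complex.I * J w 0)) := by
      rw [hV0, hV1, hV0, hV1, Matrix.det_fin_two]
      simp only [map_sub, map_mul]
      ring
    rw [add_mul, mul_assoc, ← hdetV]
    simp only [map_sub, map_mul, Complex.conj_I]
    linear_combination -t2 - Complex.I * t3 - Complex.I * t4 + t1 - t5 - t6 - hN2 +
      Complex.I * hNJ + (n 2 * (J v 0 * J w 1 - J v 1 * J w 0) +
        r 2 * (conj (J v 0) * conj (J w 1) - conj (J v 1) * conj (J w 0))) * I2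
  refine ⟨X, -(r 0 - n 0 * X 0 0 - n 1 * X 1 0) / n 2, -(r 1 - n 0 * X 0 1 - n 1 * X 1 1) / n 2,
    fun v => ?_⟩
  have hα2 (v : E) : coframe 1 1 X (-(r 0 - n 0 * X 0 0 - n 1 * X 1 0) / n 2)
      (-(r 1 - n 0 * X 0 1 - n 1 * X 1 1) / n 2) v 2 = -((v 2 - Complex.I * J v 2) -
        n 0 * ((p' 1 * (v 0 - Complex.I * J v 0) - p 1 * (v 1 - Complex.I * J v 1)) / D) -
        n 1 * ((p 0 * (v 1 - Complex.I * J v 1) - p' 0 * (v 0 - Complex.I * J v 0)) / D)) /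
          n 2 := by
    rw [← hα0, ← hα1, h2, coframe_apply_two]
    have : X.det = -r 2 / n 2 := by
      field_simp
      linear_combination hdet
    rw [this, Complex.ofReal_one]
    field_simp
    ring
  refine ext_coords ?_ ?_ ?_
  · simp only [Pi.smul_apply, smul_eq_mul, coframe_apply_zero, Complex.ofReal_one, one_mul]
    rw [hα0, hα0, hβ, hβ]
    ring
  · simp only [Pi.smul_apply, smul_eq_mul, coframe_apply_one, Complex.ofReal_one, one_mul]
    rw [hα1, hα1, hβ, hβ]
    ring
  · rw [Pi.smul_apply, smul_eq_mul, hα2, hα2, hβ, hβ, hβ]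
    ring

/-- `X` is consimilar to a normal form if it has no coneigenvectors. -/
theorem exists_normalForm (X : Matrix (Fin 2) (Fin 2) ℂ)
    (hX : ∀ v₀ v₁ : ℂ, v₀ ≠ 0 ∨ v₁ ≠ 0 →
      v₀ * (X 1 0 * conj v₀ + X 1 1 * conj v₁) - v₁ * (X 0 0 * conj v₀ + X 0 1 * conj v₁) ≠ 0) :
    ∃ (P : GL (Fin 2) ℂ) (z : ℂ), X = normalForm P z := by
  obtain ⟨z, hz⟩ := Module.End.exists_eigenvalue (Matrix.toLin' (X * X.map conj))
  obtain ⟨v, hv⟩ := hz.exists_hasEigenvector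
  have hv1 := hv.apply_eq_smul
  rw [Matrix.toLin'_apply] at hv1
  have e0 := congrFun hv1 0
  have e1 := congrFun hv1 1
  simp [Matrix.mulVec, dotProduct, Matrix.mul_apply, Fin.sum_univ_two] at e0 e1
  have hne : v 0 ≠ 0 ∨ v 1 ≠ 0 := by
    by_contra! h
    exact hv.2 (by ext i; fin_cases i <;> simp [h])
  let Q : Matrix (Fin 2) (Fin 2) ℂ := !![v 0, X 0 0 * conj (v 0) + X 0 1 * conj (v 1);
    v 1, X 1 0 * conj (v 0) + X 1 1 * conj (v 1)]
  have hQ : IsUnit Q.det := by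
    refine isUnit_iff_ne_zero.2 fun h => hX _ _ hne ?_
    rw [Matrix.det_fin_two_of] at h
    linear_combination h
  let Q' : GL (Fin 2) ℂ := Matrix.GeneralLinearGroup.mk'' Q hQ
  -- The columns of Q are v and X v̄, and X maps their conjugates to X v̄ and X X̄ v = z v.
  have hXQ : X * Q.map conj = Q * !![0, z; 1, 0] := by
    ext i j
    fin_cases i <;> fin_cases j <;> simp [Q, Matrix.mul_apply, Fin.sum_univ_two]
    · linear_combination e0
    · linear_combination e1
  refine ⟨Q'⁻¹, z, ?_⟩
  have h1 : Q.map conj * ((Q'⁻¹ : GL (Fin 2) ℂ).val.map conj) = 1 := by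
    rw [← Matrix.map_mul]
    have h2 : Q * (Q'⁻¹ : GL (Fin 2) ℂ).val = 1 := by
      have : Q'.val * (Q'⁻¹ : GL (Fin 2) ℂ).val = 1 := by
        rw [← Units.val_mul, mul_inv_cancel, Units.val_one]
      exact this
    rw [h2]
    ext i j
    fin_cases i <;> fin_cases j <;> simp
  rw [normalForm, inv_inv]
  change X = Q * !![0, z; 1, 0] * _
  rw [← hXQ, mul_assoc, h1, mul_one]

theorem exists_normalForm_of_isSKT {J : E →L[ℝ] E} (hJ : J ∈ complexStructures) (hskt : IsSKT J) :
    ∃ (P : GL (Fin 2) ℂ) (z x y : ℂ),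
      ∀ v, coframe 1 1 (normalForm P z) x y (J v) =
        Complex.I • coframe 1 1 (normalForm P z) x y v := by
  obtain ⟨X, x, y, h⟩ := exists_coframe hJ hskt
  obtain ⟨P, z, rfl⟩ := exists_normalForm X fun v₀ v₁ hv hX => by
    have h0 (v : E) := congrFun (h v) 0
    have h1 (v : E) := congrFun (h v) 1
    simp only [coframe_apply_zero, coframe_apply_one, Pi.smul_apply, smul_eq_mul,
      Complex.ofReal_one, one_mul] at h0 h1
    -- By `hX` the antilinear coefficients of v₀α² - v₁α¹ annihilate v̄, so they are proportional to
    -- (-v̄₁, v̄₀): the form is π + kπ̄ with π = -v₁ω¹ + v₀ω².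
    obtain ⟨k, k0, k1⟩ : ∃ k, v₀ * X 1 0 - v₁ * X 0 0 = -k * conj v₁ ∧
        v₀ * X 1 1 - v₁ * X 0 1 = k * conj v₀ := by
      by_cases hv0 : v₀ = 0
      · have hv1 : conj v₁ ≠ 0 := by simpa [hv0] using hv
        refine ⟨v₁ * X 0 0 / conj v₁, ?_, ?_⟩
        · rw [hv0]
          field_simp
          ring
        · rw [hv0] at hX ⊢
          simp only [map_zero, mul_zero, zero_mul, zero_add, zero_sub] at hX ⊢
          refine mul_right_cancel₀ hv1 ?_
          linear_combination hX
      · have hv0' : conj v₀ ≠ 0 := (map_ne_zero conj).2 hv0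
        refine ⟨(v₀ * X 1 1 - v₁ * X 0 1) / conj v₀, ?_, ?_⟩
        · field_simp
          linear_combination hX
        · field_simp
    refine not_oneZero_of_isSKT hJ hskt (p₀ := -v₁) (p₁ := v₀) (l := 1) (k := k)
      (by simpa [or_comm] using hv) (Or.inl one_ne_zero) fun v => ?_
    simp only [map_add, map_mul, map_neg]
    linear_combination v₀ * h1 v - v₁ * h0 v - conj (J v 0) * k0 - conj (J v 1) * k1 +
      Complex.I * (conj (v 0) * k0 + conj (v 1) * k1)
  exact ⟨P, z, x, y, h⟩

/-- For z = 1 the P-combinations of α¹, α² are conjugate to each other; for |z| = 1 the form α³ on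
the centre is proportional to its conjugate. In both cases a nonzero form would be of types (1,0)
and (0,1) at once. -/
theorem ne_of_normalForm {P : GL (Fin 2) ℂ} {z x y : ℂ} {J : E →L[ℝ] E}
    (hJ : J ∈ complexStructures)
    (h : ∀ v, coframe 1 1 (normalForm P z) x y (J v) =
        Complex.I • coframe 1 1 (normalForm P z) x y v) : z ≠ 1 ∧ ‖z‖ ≠ 1 := by
  have hP : P.val.det ≠ 0 := (Matrix.isUnits_det_units P).ne_zero
  have I2 : Complex.I * Complex.I = -1 := Complex.I_mul_I
  constructor
  · rintro rfl
    have hc (v : E) : chg P.val (coframe 1 1 (normalForm P 1) x y (J v)) =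
        Complex.I • chg P.val (coframe 1 1 (normalForm P 1) x y v) := by rw [h, chg_smul]
    have a1 (v : E) : chg P.val v 1 + conj (chg P.val v 0) = 0 := by
      have h0 := congrArg conj (congrFun (hc v) 0)
      have h1 := congrFun (hc v) 1
      simp only [Pi.smul_apply, smul_eq_mul, chg_coframe_zero, chg_coframe_one, map_add, map_mul,
        Complex.conj_I, Complex.conj_conj, Complex.ofReal_one, one_mul] at h0 h1
      have h2 : 2 * Complex.I * (chg P.val v 1 + conj (chg P.val v 0)) = 0 := by
        linear_combination h0 - h1
      exact (mul_eq_zero.1 h2).resolve_left (mul_ne_zero two_ne_zero Complex.I_ne_zero)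
    have w1 (v : E) : chg P.val v 1 = 0 := by
      have k0 := a1 v
      have k1 := a1 (Complex.I • v)
      rw [chg_smul] at k1
      simp only [Pi.smul_apply, smul_eq_mul, map_mul, Complex.conj_I] at k1
      linear_combination (k0 - Complex.I * k1 +
        (chg P.val v 1 - conj (chg P.val v 0)) * I2) / 2
    have w0 (v : E) : chg P.val v 0 = 0 := by
      simpa [w1] using a1 v
    have := det_mul_apply_zero P.val ![1, 0, 0]
    rw [w0, w1] at this
    simp at this
    exact hP this
  · intro hz
    set D := (normalForm P z).det with hD
    have hDD : D * conj D = 1 := by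
      rw [Complex.mul_conj', hD, norm_det_normalForm, hz]
      simp
    have f (c : E) (c0 : c 0 = 0) (c1 : c 1 = 0) : -c 2 + D * conj (c 2) = 0 := by
      obtain ⟨d0, d1⟩ := apply_central hJ c0 c1
      have h2 := congrFun (h c) 2
      simp only [Pi.smul_apply, smul_eq_mul, coframe_apply_two, c0, c1, d0, d1, map_zero,
        Complex.ofReal_one, mul_zero, add_zero, one_pow, one_mul, ← hD, neg_mul] at h2
      have h3 := congrArg conj h2
      simp only [map_add, map_mul, map_neg, Complex.conj_I, Complex.conj_conj] at h3
      have h4 : 2 * Complex.I * (-c 2 + D * conj (c 2)) = 0 := by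
        linear_combination -h2 - D * h3 +
          (J c 2 + Complex.I * c 2) * hDD
      exact (mul_eq_zero.1 h4).resolve_left (mul_ne_zero two_ne_zero Complex.I_ne_zero)
    have f0 := f ![0, 0, 1] rfl rfl
    have f1 := f ![0, 0, Complex.I] rfl rfl
    simp at f0 f1
    have : (2 : ℂ) = 0 := by
      linear_combination -f0 + Complex.I * f1 + (1 + D) * I2
    norm_num at this

/-! ### Existence of Hermitian metrics -/

theorem exists_isHermitianMetric {A J : E →L[ℝ] E} (hA : Function.Injective A)
    (hJ : ∀ v, A (J v) = Complex.I • A v) : ∃ g, IsHermitianMetric J g := by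
  let p (i : Fin 3) : E →L[ℝ] ℂ := (ContinuousLinearMap.proj i : E →L[ℝ] ℂ).comp A
  let g : E →L[ℝ] E →L[ℝ] ℝ := ∑ i, (innerSL ℝ (E := ℂ)).bilinearComp (p i) (p i)
  have hg (v w : E) : g v w = ∑ i, inner ℝ (A v i) (A w i) := by simp [g, p]
  refine ⟨g, fun v w => ?_, fun v hv => ?_, fun v w => ?_⟩
  · rw [hg, hg]
    exact Finset.sum_congr rfl fun i _ => real_inner_comm _ _
  · rw [hg]
    have hAv : A v ≠ 0 := fun h => hv (hA (by rw [h, map_zero]))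
    obtain ⟨i, hi⟩ := Function.ne_iff.1 hAv
    exact Finset.sum_pos' (fun i _ => real_inner_self_nonneg)
      ⟨i, Finset.mem_univ i, real_inner_self_pos.2 hi⟩
  · rw [hg, hg]
    refine Finset.sum_congr rfl fun i _ => ?_
    rw [hJ, hJ]
    simp [Complex.inner]

/-! ### Connectedness -/

theorem ofCoframe_mem_connectedComponentIn {s t : ℝ → ℝ} (hs : Continuous s) (ht : Continuous t)
    {P : GL (Fin 2) ℂ} {z x y : ℂ}
    (h : ∀ r ∈ Set.Icc (0 : ℝ) 1, s r ^ 2 ≠ t r ^ 2 * ‖z‖) :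
    ofCoframe (coframe (s 1) (t 1) (normalForm P z) x y) ∈
      connectedComponentIn complexStructures
        (ofCoframe (coframe (s 0) (t 0) (normalForm P z) x y)) := by
  have hinj (r : ℝ) (hr : r ∈ Set.Icc (0 : ℝ) 1) := injective_coframe P x y (h r hr)
  have hcont : ContinuousOn (fun r => ofCoframe (coframe (s r) (t r) (normalForm P z) x y))
      (Set.Icc 0 1) := by
    have hc : Continuous fun r => coframe (s r) (t r) (normalForm P z) x y := by
      unfold coframe
      fun_prop
    intro r hr
    obtain ⟨a, ha⟩ := isUnit_of_injective (hinj r hr)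
    have hi := NormedRing.inverse_continuousAt a
    rw [ha] at hi
    have hi' : ContinuousAt
        (fun r => Ring.inverse (coframe (s r) (t r) (normalForm P z) x y)) r :=
      ContinuousAt.comp (f := fun r => coframe (s r) (t r) (normalForm P z) x y) hi hc.continuousAt
    exact ((hi'.mul continuousAt_const).mul hc.continuousAt).continuousWithinAt
  refine (isPreconnected_Icc.image _ hcont).subset_connectedComponentIn
    (Set.mem_image_of_mem _ (Set.left_mem_Icc.2 zero_le_one)) ?_
    (Set.mem_image_of_mem _ (Set.right_mem_Icc.2 zero_le_one))
  rintro _ ⟨r, hr, rfl⟩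
  exact mem_complexStructures_of_coframe (hinj r hr) (apply_ofCoframe (hinj r hr))

theorem ofCoframe_one_zero (X : Matrix (Fin 2) (Fin 2) ℂ) (x y : ℂ)
    (hA : Function.Injective (coframe 1 0 X x y)) : ofCoframe (coframe 1 0 X x y) = J₀ := by
  refine (eq_ofCoframe hA fun v => ext_coords ?_ ?_ ?_).symm <;>
    simp [coframe_apply_zero, coframe_apply_one, coframe_apply_two, J₀_apply]

theorem ofCoframe_zero_one (X : Matrix (Fin 2) (Fin 2) ℂ) (x y : ℂ)
    (hA : Function.Injective (coframe 0 1 X x y)) : ofCoframe (coframe 0 1 X x y) = -J₀ := by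
  refine (eq_ofCoframe hA fun v => ext_coords ?_ ?_ ?_).symm <;>
    simp [coframe_apply_zero, coframe_apply_one, coframe_apply_two, J₀_apply] <;> ring

/-- The coframe with (s,t) = (1,0) defines J₀ and the one with (0,1) defines -J₀. The segment to
(1,1) avoids the degenerate locus s² = t²|z| from the first end if |z| < 1, from the second if |z| >
1. -/
theorem mem_connectedComponentIn_of_normalForm {P : GL (Fin 2) ℂ} {z x y : ℂ} {J : E →L[ℝ] E}
    (hz : ‖z‖ ≠ 1)
    (h : ∀ v, coframe 1 1 (normalForm P z) x y (J v) =
        Complex.I • coframe 1 1 (normalForm P z) x y v) :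
    J ∈ connectedComponentIn complexStructures J₀ ∪
      connectedComponentIn complexStructures (-J₀) := by
  have hA : Function.Injective (coframe 1 1 (normalForm P z) x y) :=
    injective_coframe P x y (by simpa using hz.symm)
  rw [eq_ofCoframe hA h]
  rcases lt_or_gt_of_ne hz with hz | hz
  · left
    have hr (r : ℝ) (hr : r ∈ Set.Icc (0 : ℝ) 1) : (1 : ℝ) ^ 2 ≠ r ^ 2 * ‖z‖ := by
      have h1 : r ^ 2 ≤ 1 := pow_le_one₀ hr.1 hr.2
      have h2 : r ^ 2 * ‖z‖ ≤ 1 * ‖z‖ := mul_le_mul_of_nonneg_right h1 (norm_nonneg z)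
      intro h
      linarith
    rw [← ofCoframe_one_zero (normalForm P z) x y (injective_coframe P x y (by simp))]
    exact ofCoframe_mem_connectedComponentIn (s := fun _ => 1) (t := fun r => r)
      continuous_const continuous_id hr
  · right
    have hz0 : ‖z‖ ≠ 0 := by linarith
    have hr (r : ℝ) (hr : r ∈ Set.Icc (0 : ℝ) 1) : r ^ 2 ≠ (1 : ℝ) ^ 2 * ‖z‖ := by
      have h1 : r ^ 2 ≤ 1 := pow_le_one₀ hr.1 hr.2
      intro h
      linarith
    rw [← ofCoframe_zero_one (normalForm P z) x y
      (injective_coframe P x y (by simpa using hz0.symm))]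
    exact ofCoframe_mem_connectedComponentIn (s := fun r => r) (t := fun _ => 1)
      continuous_id continuous_const hr

/-! ### The curve -/

/-- For |z| = 1 the equation reads |1+z| = 2, whose only solution on the unit circle is z = 1. -/
theorem norm_ne_one_of_mem_curve {z : ℂ} (hz : z ∈ curve) : ‖z‖ ≠ 1 := by
  intro h1
  obtain ⟨h, hne⟩ := hz
  have h2 : Complex.normSq z = 1 := by rw [Complex.normSq_eq_norm_sq, h1, one_pow]
  rw [h1, ← Complex.normSq_eq_norm_sq] at h
  rw [Complex.normSq_apply] at h h2
  simp at h
  have hre : z.re = 1 := by linarith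
  have him : z.im = 0 := by
    rw [hre] at h2
    have : z.im * z.im = 0 := by linarith
    simpa using this
  exact hne (Complex.ext hre him)

theorem isJ_normalForm_iff {P : GL (Fin 2) ℂ} {z x y : ℂ} {J : E →L[ℝ] E} (hz : ‖z‖ ≠ 1) :
    IsJ (normalForm P z) x y J ↔ ∀ v, coframe 1 1 (normalForm P z) x y (J v) =
        Complex.I • coframe 1 1 (normalForm P z) x y v :=
  isJ_iff (injective_coframe P x y (by simpa using hz.symm))

theorem isSKTMetric_of_isJ {P : GL (Fin 2) ℂ} {z x y : ℂ} {J : E →L[ℝ] E}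
    (hJ : J ∈ complexStructures) (hz : z ∈ curve) (h : IsJ (normalForm P z) x y J)
    {g : E →L[ℝ] E →L[ℝ] ℝ} (hg : IsHermitianMetric J g) : IsSKTMetric J g := by
  have hz1 := norm_ne_one_of_mem_curve hz
  rw [isSKTMetric_iff hJ hg,
    sktForm_eq_zero_iff hz.2 hz1 ((isJ_normalForm_iff hz1).1 h) hg]
  exact hz

theorem isSKT_iff {J : E →L[ℝ] E} (hJ : J ∈ complexStructures) :
    IsSKT J ↔ ∃ (P : GL (Fin 2) ℂ) (z x y : ℂ), z ∈ curve ∧ IsJ (normalForm P z) x y J := by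
  constructor
  · intro hskt
    obtain ⟨P, z, x, y, h⟩ := exists_normalForm_of_isSKT hJ hskt
    obtain ⟨hz1, hz⟩ := ne_of_normalForm hJ h
    obtain ⟨g, hg⟩ := hskt
    exact ⟨P, z, x, y, (sktForm_eq_zero_iff hz1 hz h hg.1).1 ((isSKTMetric_iff hJ hg.1).1 hg),
      (isJ_normalForm_iff hz).2 h⟩
  · rintro ⟨P, z, x, y, hz, h⟩
    have hz1 := norm_ne_one_of_mem_curve hz
    obtain ⟨g, hg⟩ := exists_isHermitianMetric
      (injective_coframe P x y (by simpa using hz1.symm)) ((isJ_normalForm_iff hz1).1 h)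
    exact ⟨g, isSKTMetric_of_isJ hJ hz h hg⟩

end Iwasawa

/-! ### The four assertions together -/

theorem mainTheorem3 :
    (∀ (P : GL (Fin 2) ℂ) (z x y : ℂ), z ∈ Iwasawa.curve →
      ∃! J : Iwasawa.E →L[ℝ] Iwasawa.E,
        J ∈ Iwasawa.complexStructures ∧ Iwasawa.IsJ (Iwasawa.normalForm P z) x y J) ∧
    (∀ J ∈ Iwasawa.complexStructures,
      (Iwasawa.IsSKT J ↔
        ∃ (P : GL (Fin 2) ℂ) (z x y : ℂ), z ∈ Iwasawa.curve ∧
          Iwasawa.IsJ (Iwasawa.normalForm P z) x y J)) ∧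
    (∀ J ∈ Iwasawa.complexStructures, Iwasawa.IsSKT J →
      ∀ g : Iwasawa.E →L[ℝ] Iwasawa.E →L[ℝ] ℝ,
        Iwasawa.IsHermitianMetric J g → Iwasawa.IsSKTMetric J g) ∧
    (∀ J ∈ Iwasawa.complexStructures, Iwasawa.IsSKT J →
      J ∈ connectedComponentIn Iwasawa.complexStructures Iwasawa.J₀ ∪
        connectedComponentIn Iwasawa.complexStructures (-Iwasawa.J₀)) := by
  refine ⟨fun P z x y hz => ?_, fun J hJ => Iwasawa.isSKT_iff hJ, fun J hJ hskt g hg => ?_,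
    fun J hJ hskt => ?_⟩
  · have hz1 := Iwasawa.norm_ne_one_of_mem_curve hz
    have hA : Function.Injective (Iwasawa.coframe 1 1 (Iwasawa.normalForm P z) x y) :=
      Iwasawa.injective_coframe P x y (by simpa using hz1.symm)
    have h := Iwasawa.apply_ofCoframe hA
    refine ⟨_, ⟨Iwasawa.mem_complexStructures_of_coframe hA h,
      (Iwasawa.isJ_normalForm_iff hz1).2 h⟩, fun J hJ => ?_⟩
    exact Iwasawa.eq_ofCoframe hA ((Iwasawa.isJ_normalForm_iff hz1).1 hJ.2)
  · obtain ⟨P, z, x, y, hz, h⟩ := (Iwasawa.isSKT_iff hJ).1 hskt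
    exact Iwasawa.isSKTMetric_of_isJ hJ hz h hg
  · obtain ⟨P, z, x, y, hz, h⟩ := (Iwasawa.isSKT_iff hJ).1 hskt
    have hz1 := Iwasawa.norm_ne_one_of_mem_curve hz
    exact Iwasawa.mem_connectedComponentIn_of_normalForm hz1
      ((Iwasawa.isJ_normalForm_iff hz1).1 h)
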